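/- Let $a,b\in\mathbb R$. For $r\in\mathbb R$, $t\ge 0$ put $\varphi_r(t)=\frac{1-e^{-2rt}}{2r}$ (with $\varphi_0(t)=t$), and let $v(t)=\varphi_a(t)$, $\mu_t=\mathcal N(0,v(t))$. For probability measures $\mu,\nu$ on $\mathbb R^k$ such that $\mu$ has a positive $C^1$ density $f$ with respect to $\nu$, let $I(\mu|\nu)=\int f\,\|\nabla\log f\|^2\,d\nu$. Write $I_k$ for the identity matrix and $J_k$ for the $k\times k$ matrix of all ones. All processes below are continuous, start from $0$, and are driven by (independent) standard real Brownian motions. "$k$-marginal" means the law at time $t$ of $k$ distinct particles. **0. Limit.** For every $t\ge0$, any solution of $dX=(-aX- b\,\mathbb E[X])dt+dW$, or of $dX=(-aX+ b\,\mathbb E[X])dt+dW$, with integrable $X_t$ and locally integrable mean, has law $\mu_t$ at time $t$. **1. First system.** For $n\ge2$ consider $$dX^i_t=\Big(-aX^i_t-\frac{b}{n-1}\sum_{j=1}^{n}X^j_t\Big)dt+dW^i_t,\qquad 1\le i\le n.$$ Put $c_n(t)=\frac1n\Big(1-\frac{\varphi_{a+bn/(n-1)}(t)}{v(t)}\Big)$,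 $\alpha(t)=1-\frac{\varphi_{a+b}(t)}{v(t)}$, $\beta(t)=1-\frac{\varphi_{a+2b}(t)}{v(t)}$. Let $t>0$. Then $v(t)>0$ and $1-\beta(t)>0$; for all $n\ge2$ one has $\frac{\alpha(t)}n\le c_n(t)\le\frac{\beta(t)}n$ if $b\ge0$ and $\frac{\beta(t)}n\le c_n(t)\le\frac{\alpha(t)}n$ if $b\le0$. For all $n\ge2$, $1\le k\le n$, the $k$-marginal $\mu^{k,n}_t$ is the centered Gaussian with (positive definite) covariance matrix $v(t)(I_k-c_n(t)J_k)$, $1-c_n(t)k>0$, and $I^k_t:=I(\mu^{k,n}_t|\mu_t^{\otimes k})$ equals $$I^k_t=\frac{c_n(t)^2k^2}{v(t)(1-c_n(t)k)}.$$ Moreover $$\frac{\alpha(t)^2}{v(t)}\frac{k^2}{n^2}\le I^k_t\le\frac{\beta(t)^2}{v(t)(1-\beta(t))}\frac{k^2}{n^2}\quad(b\ge0),\qquad \frac{\alpha(t)^2}{v(t)(1-\beta(t))}\frac{k^2}{n^2}\le I^k_t\le\frac{\beta(t)^2}{v(t)}\frac{k^2}{n^2}\quad(b\le0),$$ and $\alpha(t)^2>0$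 whenever $b\ne0$; so $I^k_t$ is exactly of order $k^2/n^2$ and the rate $k^2/n^2$ is optimal. For fixed $k$, $\mu^{k,n}_t\to\mu_t^{\otimes k}$ weakly as $n\to\infty$. Finally, if $a>0$ and $a+b>0$, there are $n_0\ge2$ and $C$ such that $I^k_t\le Ck^2/n^2$ for all $t>0$, $n\ge n_0$, $1\le k\le n$; and if moreover $b\neq0$, then for each $t_0>0$ there is $c>0$ with $I^k_t\ge ck^2/n^2$ for all $t\ge t_0$, $n\ge n_0$, $1\le k\le n$. **2. Second system.** For $n\ge2$ consider $$dX^i_t=\Big(-aX^i_t+\frac{b}{n-1}\sum_{j\ne i}X^j_t\Big)dt+dW^i_t,\qquad 1\le i\le n.$$ Put $v_n(t)=\varphi_{a+b/(n-1)}(t)$, $\tilde c_n(t)=\frac1n\Big(1-\frac{\varphi_{a-b}(t)}{v_n(t)}\Big)$ and let $t>0$. For $1\le k\le n$, $v_n(t)>0$, $1-\tilde c_n(t)k>0$, the $k$-marginal $\mu^{k,n}_t$ is the centered Gaussian with (positive definite) covariance matrix $v_n(t)(I_k-\tilde c_n(t)J_k)$, and with $e_{n,k}(t)=v_n(t)(1-\tilde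 c_n(t)k)$, $$I(\mu^{k,n}_t|\mu_t^{\otimes k})=(k-1)\frac{(v_n(t)-v(t))^2}{v(t)^2v_n(t)}+\frac{(e_{n,k}(t)-v(t))^2}{v(t)^2e_{n,k}(t)} .$$ There is $C$ depending only on $a,b,t$ with $I(\mu^{k,n}_t|\mu_t^{\otimes k})\le Ck^2/n^2$ for all $n\ge2$, $1\le k\le n$, and, if $b\ne0$, there is $c>0$ depending only on $a,b,t$ with $I(\mu^{k,n}_t|\mu_t^{\otimes k})\ge ck^2/n^2$ for all $n\ge2$, $1\le k\le n$: again the rate $k^2/n^2$ is optimal. For fixed $k$, $\mu^{k,n}_t\to\mu_t^{\otimes k}$ weakly as $n\to\infty$. -/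

import Mathlib

open MeasureTheory ProbabilityTheory
open scoped NNReal ENNReal BoundedContinuousFunction

universe u

/-- `X` is a (continuous) solution on `[0, ∞)`, started from `0`, of the system
`dX^i = F_i(X) dt + dW^i`, `i = 1, …, n`, where `W^1, …, W^n` are independent standard Brownian
motions. As the noise is additive, the equation is the pathwise integral equation. -/
structure IsAdditiveNoiseSolution {Ω : Type u} [MeasurableSpace Ω] (P : Measure Ω) {n : ℕ}
    (F : (Fin n → ℝ) → Fin n → ℝ) (W X : Fin n → ℝ≥0 → Ω → ℝ) : Prop where
  brownian : ∀ i, IsBrownianReal (W i) P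
  indep : iIndepFun (fun i ω (t : ℝ≥0) => W i t ω) P
  aemeasurable : ∀ i t, AEMeasurable (X i t) P
  continuous_paths : ∀ᵐ ω ∂P, ∀ i, Continuous fun t => X i t ω
  equation : ∀ᵐ ω ∂P, ∀ (i : Fin n) (t : ℝ≥0),
    X i t ω = (∫ s in (0 : ℝ)..t, F (fun j => X j s.toNNReal ω) i) + W i t ω

/-- `μ` is the law at time `t` of `k` distinct particles of some solution, started from `0`, of the
system `dX^i = F_i(X) dt + dW^i`, on some probability space. -/
def IsMarginalLaw {n : ℕ} (F : (Fin n → ℝ) → Fin n → ℝ) (t : ℝ≥0) (k : ℕ)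
    (μ : Measure (EuclideanSpace ℝ (Fin k))) : Prop :=
  ∃ (Ω : Type u) (_ : MeasurableSpace Ω) (P : Measure Ω) (W X : Fin n → ℝ≥0 → Ω → ℝ)
    (e : Fin k ↪ Fin n), IsProbabilityMeasure P ∧ IsAdditiveNoiseSolution P F W X ∧
      μ = P.map fun ω => WithLp.toLp 2 fun i => X (e i) t ω

/-- `X` is a (continuous) solution on `[0, ∞)`, started from `0`, of the McKean–Vlasov equation
`dX = (-a X + q E[X]) dt + dW`, with `W` a standard Brownian motion. -/
structure IsMcKeanVlasovSolution {Ω : Type u} [MeasurableSpace Ω] (P : Measure Ω)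
    (a q : ℝ) (W X : ℝ≥0 → Ω → ℝ) : Prop where
  brownian : IsBrownianReal W P
  integrable : ∀ t, Integrable (X t) P
  intervalIntegrable_mean : ∀ t : ℝ≥0,
    IntervalIntegrable (fun s : ℝ => ∫ ω, X s.toNNReal ω ∂P) volume 0 t
  continuous_paths : ∀ᵐ ω ∂P, Continuous fun t => X t ω
  equation : ∀ᵐ ω ∂P, ∀ t : ℝ≥0,
    X t ω = (∫ s in (0 : ℝ)..t, (-a * X s.toNNReal ω + q * ∫ ω', X s.toNNReal ω' ∂P)) + W t ω

/-- `μ` is the law at time `t` of some solution of the McKean–Vlasov equation above. -/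
def IsMcKeanVlasovLaw (a q : ℝ) (t : ℝ≥0) (μ : Measure ℝ) : Prop :=
  ∃ (Ω : Type u) (_ : MeasurableSpace Ω) (P : Measure Ω) (W X : ℝ≥0 → Ω → ℝ),
    IsProbabilityMeasure P ∧ IsMcKeanVlasovSolution P a q W X ∧ μ = P.map (X t)

noncomputable section

/-- The drift `-a x_i - (b / (n - 1)) ∑_{j} x_j` (sum over all particles). -/
def fullSumDrift (a b : ℝ) (n : ℕ) (x : Fin n → ℝ) (i : Fin n) : ℝ :=
  -a * x i - b / ((n : ℝ) - 1) * ∑ j, x j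

/-- The drift `-a x_i + (b / (n - 1)) ∑_{j ≠ i} x_j`. -/
def otherSumDrift (a b : ℝ) (n : ℕ) (x : Fin n → ℝ) (i : Fin n) : ℝ :=
  -a * x i + b / ((n : ℝ) - 1) * ∑ j ∈ Finset.univ.erase i, x j

/-- `(1 - e^{-2 r t}) / (2 r)`, extended by its limit `t` at `r = 0`. -/
def ouVar (r t : ℝ) : ℝ := if r = 0 then t else (1 - Real.exp (-2 * r * t)) / (2 * r)

/-- `c_n(t)` for the system with drift `fullSumDrift`. For `a ≠ 0` and `a + b n / (n - 1) ≠ 0` this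
is `(1/n) (1 - (a / (a + bn/(n-1))) (1 - e^{-2t(a + bn/(n-1))}) / (1 - e^{-2at}))`. -/
def corrCoef (a b : ℝ) (n : ℕ) (t : ℝ) : ℝ :=
  1 / n * (1 - ouVar (a + b * n / ((n : ℝ) - 1)) t / ouVar a t)

/-- `α(t) = 1 - (a / (a + b)) (1 - e^{-2(a+b)t}) / (1 - e^{-2at})`. -/
def alphaCoef (a b t : ℝ) : ℝ := 1 - ouVar (a + b) t / ouVar a t

/-- `β(t) = 1 - (a / (a + 2b)) (1 - e^{-2(a+2b)t}) / (1 - e^{-2at})`. -/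
def betaCoef (a b t : ℝ) : ℝ := 1 - ouVar (a + 2 * b) t / ouVar a t

/-- Diagonal parameter of the covariance for the system with drift `otherSumDrift`. -/
def otherVar (a b : ℝ) (n : ℕ) (t : ℝ) : ℝ := ouVar (a + b / ((n : ℝ) - 1)) t

/-- Correlation parameter of the covariance for the system with drift `otherSumDrift`. -/
def otherCorrCoef (a b : ℝ) (n : ℕ) (t : ℝ) : ℝ :=
  1 / n * (1 - ouVar (a - b) t / otherVar a b n t)

/-- The `k × k` matrix `v (I_k - c J_k)`, with `J_k` the matrix of all ones. -/
def covMat (v c : ℝ) (k : ℕ) : Matrix (Fin k) (Fin k) ℝ :=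
  v • (1 - c • Matrix.of fun _ _ => (1 : ℝ))

/-- The tensor power `μ ^ {⊗ k}` on Euclidean space. -/
def tensorPower (μ : Measure ℝ) (k : ℕ) : Measure (EuclideanSpace ℝ (Fin k)) :=
  (Measure.pi fun _ : Fin k => μ).map (WithLp.toLp 2)

/-- The limit law `N(0, v(t))`, `v(t) = (1 - e^{-2at}) / (2a)`. -/
def limitLaw (a : ℝ) (t : ℝ) : Measure ℝ := gaussianReal 0 (ouVar a t).toNNReal

/-- Relative Fisher information `I(μ | ν) = ∫ f ‖∇ log f‖² dν`, where `f` is the positive `C¹`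
density of `μ` with respect to `ν` (`∞` if there is none). When `ν` has full support such a density
is unique, so that the infimum ranges over at most one function. -/
def fisherInfo {k : ℕ} (μ ν : Measure (EuclideanSpace ℝ (Fin k))) : ℝ≥0∞ :=
  ⨅ (f : EuclideanSpace ℝ (Fin k) → ℝ) (_ : ContDiff ℝ 1 f) (_ : ∀ x, 0 < f x)
    (_ : μ = ν.withDensity fun x => ENNReal.ofReal (f x)),
    ∫⁻ x, ENNReal.ofReal (f x * ‖gradient (fun y => Real.log (f y)) x‖ ^ 2) ∂ν

end

/-! ### The variance of the Ornstein–Uhlenbeck process -/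

/-! Both systems have drift `-A x_i - B ∑ x_j`, which acts as the rate `A` on vectors of zero sum
and as the rate `A + n B` on constant vectors. Splitting a direction `p` into its mean and the rest
(`sum_mul_eq_of_meanField`) writes `∑ p_i X^i` as two scalar Ornstein–Uhlenbeck responses to the
noise. The noise being additive, this holds path by path, and the responses are Wiener integrals of
smooth kernels, which integration by parts turns into ordinary integrals. Their joint characteristic
function is a limit of those of Riemann sums (`integral_cexp_sum_wienerIntegral`), so the law of
every solution is determined, with no stochastic calculus. The `k`-marginal has covariance `v (I - c
J)` with `v = φ_A`, whose eigenvalue on the vector of ones is the convex combination `(1 - k/n) φ_A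
+ (k/n) φ_{A+nB}` (`mul_one_sub_eq`).

The reference measure is isotropic, hence a product in an eigenbasis of that covariance. There the
log-density is a diagonal quadratic form and the Fisher information is `∑ (l_i - v)² / (v² l_i)`
over the eigenvalues `l_i` (`fisherInfo_diagGaussian`).

What remains is calculus of `r ↦ φ_r(t)`, read off from its form as an integral of exponentials. In
the first system only one eigenvalue differs from `v`, and monotonicity in `r` gives the bounds. In
the second all eigenvalues differ: `k - 1` of them by `O(1/n)`, one by `O(k/n)`. The lower bound
must exclude a cancellation in the diagonal entries, and strict convexity of `r ↦ φ_r(t)`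
(`ouVar_add_mul_deriv_lt`) does so.

In the McKean–Vlasov equations the mean solves a linear equation with zero data, so it vanishes and
`b` disappears. -/

lemma ouVar_eq_integral (r t : ℝ) : ouVar r t = ∫ s in (0 : ℝ)..t, Real.exp (-2 * r * s) := by
  unfold ouVar
  split_ifs with h
  · simp [h]
  · rw [intervalIntegral.integral_comp_mul_left (fun x => Real.exp x) (by simpa using h),
      integral_exp]
    simp
    field_simp
    ring

lemma ouVar_zero_right (r : ℝ) : ouVar r 0 = 0 := by simp [ouVar_eq_integral]

lemma ouVar_pos (r : ℝ) {t : ℝ} (ht : 0 < t) : 0 < ouVar r t := by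
  rw [ouVar_eq_integral]
  exact intervalIntegral.intervalIntegral_pos_of_pos
    (Continuous.intervalIntegrable (by fun_prop) _ _) (fun _ => Real.exp_pos _) ht

lemma ouVar_nonneg (r : ℝ) {t : ℝ} (ht : 0 ≤ t) : 0 ≤ ouVar r t := by
  rcases ht.eq_or_lt with rfl | h
  · exact (ouVar_zero_right r).ge
  · exact (ouVar_pos r h).le

lemma continuous_ouVar (t : ℝ) : Continuous fun r => ouVar r t := by
  simp_rw [ouVar_eq_integral]
  exact intervalIntegral.continuous_parametric_intervalIntegral_of_continuous'
    (f := fun r s => Real.exp (-2 * r * s)) (by fun_prop) 0 t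

lemma ouVar_sub_ouVar (r r' t : ℝ) :
    ouVar r t - ouVar r' t = ∫ s in (0 : ℝ)..t, (Real.exp (-2 * r * s) - Real.exp (-2 * r' * s)) := by
  rw [ouVar_eq_integral, ouVar_eq_integral, intervalIntegral.integral_sub] <;>
    exact Continuous.intervalIntegrable (by fun_prop) _ _

lemma ouVar_strictAnti {t : ℝ} (ht : 0 < t) : StrictAnti fun r => ouVar r t := by
  intro r r' h
  have : 0 < ouVar r t - ouVar r' t := by
    rw [ouVar_sub_ouVar]
    refine intervalIntegral.intervalIntegral_pos_of_pos_on
      (Continuous.intervalIntegrable (by fun_prop) _ _) (fun s hs => ?_) ht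
    have : r * s < r' * s := mul_lt_mul_of_pos_right h hs.1
    exact sub_pos.2 (Real.exp_lt_exp.2 (by linarith))
  simpa using this

/-- The derivative of `ouVar · t`. -/
noncomputable def ouVarDeriv (r t : ℝ) : ℝ := ∫ s in (0 : ℝ)..t, -2 * s * Real.exp (-2 * r * s)

/-- Strict convexity in the rate: `1 + x < e^x` for `x ≠ 0`, integrated. -/
lemma ouVar_add_mul_deriv_lt (r : ℝ) {h t : ℝ} (ht : 0 < t) (hh : h ≠ 0) :
    ouVar r t + h * ouVarDeriv r t < ouVar (r + h) t := by
  have : 0 < ouVar (r + h) t - ouVar r t - h * ouVarDeriv r t := by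
    rw [ouVar_sub_ouVar, ouVarDeriv, ← intervalIntegral.integral_const_mul,
      ← intervalIntegral.integral_sub (Continuous.intervalIntegrable (by fun_prop) _ _)
        (Continuous.intervalIntegrable (by fun_prop) _ _)]
    refine intervalIntegral.intervalIntegral_pos_of_pos_on
      (Continuous.intervalIntegrable (by fun_prop) _ _) (fun s hs => ?_) ht
    have h1 : -2 * h * s + 1 < Real.exp (-2 * h * s) :=
      Real.add_one_lt_exp (by simpa [hh] using hs.1.ne')
    have h2 : Real.exp (-2 * (r + h) * s) = Real.exp (-2 * r * s) * Real.exp (-2 * h * s) := by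
      rw [← Real.exp_add]; ring_nf
    rw [h2]
    nlinarith [Real.exp_pos (-2 * r * s)]
  linarith

/-- From `1 - e^{-x} ≤ x` under the integral, then `∫ s e^{-2rs} ≤ φ_r(t)²`. The square on the right
has the correct order as `t → 0`, which the bounds uniform in time need. -/
lemma ouVar_sub_le_sq {r r' t : ℝ} (h : r ≤ r') (ht : 0 ≤ t) :
    ouVar r t - ouVar r' t ≤ 2 * (r' - r) * ouVar r t ^ 2 := by
  have hint : ∫ s in (0 : ℝ)..t, s * Real.exp (-2 * r * s) ≤ ouVar r t ^ 2 := by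
    by_cases hr : r = 0
    · subst hr
      simp only [ouVar, if_pos]
      simp [integral_id]
      nlinarith [sq_nonneg t]
    · have hd : ∀ s, HasDerivAt (fun s => -(s / (2 * r) + 1 / (2 * r) ^ 2) * Real.exp (-2 * r * s))
          (s * Real.exp (-2 * r * s)) s := by
        intro s
        have h1 : HasDerivAt (fun s => -(s / (2 * r) + 1 / (2 * r) ^ 2)) (-(1 / (2 * r))) s :=
          (((hasDerivAt_id s).div_const (2 * r)).add_const _).neg
        have h2 : HasDerivAt (fun s => Real.exp (-2 * r * s)) (Real.exp (-2 * r * s) * (-2 * r)) s := by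
          simpa using ((hasDerivAt_id s).const_mul (-2 * r)).exp
        refine (h1.mul h2).congr_deriv ?_
        have : r ≠ 0 := hr
        field_simp
        ring
      rw [intervalIntegral.integral_eq_sub_of_hasDerivAt (fun s _ => hd s)
        (Continuous.intervalIntegrable (by fun_prop) _ _)]
      have hE := Real.add_one_le_exp (2 * r * t)
      have hE1 : Real.exp (-2 * r * t) * (2 * r * t + 1) ≤ 1 := by
        calc _ ≤ Real.exp (-2 * r * t) * Real.exp (2 * r * t) := by gcongr
          _ = 1 := by rw [← Real.exp_add]; simp
      have hE2 := Real.add_one_le_exp (-2 * r * t)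
      simp only [ouVar, if_neg hr]
      have hEp := Real.exp_pos (-2 * r * t)
      set E := Real.exp (-2 * r * t)
      -- The defect is explicit, and nonnegative because `E ≥ 1 - 2rt`.
      have : ((1 - E) / (2 * r)) ^ 2 - (-(t / (2 * r) + 1 / (2 * r) ^ 2) * E -
          -(0 / (2 * r) + 1 / (2 * r) ^ 2) * Real.exp (-2 * r * 0)) =
          E * (E - 1 + 2 * r * t) / (2 * r) ^ 2 := by
        simp
        field_simp
        ring
      have h3 : 0 ≤ E * (E - 1 + 2 * r * t) / (2 * r) ^ 2 :=
        div_nonneg (mul_nonneg hEp.le (by linarith)) (sq_nonneg _)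
      linarith
  calc ouVar r t - ouVar r' t
      ≤ ∫ s in (0 : ℝ)..t, 2 * (r' - r) * (s * Real.exp (-2 * r * s)) := by
        rw [ouVar_sub_ouVar]
        refine intervalIntegral.integral_mono_on ht
          (Continuous.intervalIntegrable (by fun_prop) _ _)
          (Continuous.intervalIntegrable (by fun_prop) _ _) fun s hs => ?_
        have h1 := Real.add_one_le_exp (-2 * (r' - r) * s)
        have h2 : Real.exp (-2 * r' * s) = Real.exp (-2 * r * s) * Real.exp (-2 * (r' - r) * s) := by
          rw [← Real.exp_add]; ring_nf
        rw [h2]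
        nlinarith [Real.exp_pos (-2 * r * s)]
    _ = 2 * (r' - r) * ∫ s in (0 : ℝ)..t, s * Real.exp (-2 * r * s) :=
        intervalIntegral.integral_const_mul _ _
    _ ≤ _ := by
        have : 0 ≤ 2 * (r' - r) := by linarith
        gcongr

lemma ouVar_antitone {t : ℝ} (ht : 0 ≤ t) : Antitone fun r => ouVar r t := by
  rcases ht.eq_or_lt with rfl | h
  · intro r r' _
    simp [ouVar_zero_right]
  · exact (ouVar_strictAnti h).antitone

lemma abs_ouVar_sub_le {m r r' t : ℝ} (hr : m ≤ r) (hr' : m ≤ r') (ht : 0 ≤ t) :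
    |ouVar r t - ouVar r' t| ≤ 2 * ouVar m t ^ 2 * |r - r'| := by
  wlog h : r ≤ r' generalizing r r'
  · rw [abs_sub_comm, abs_sub_comm r]
    exact this hr' hr (le_of_not_ge h)
  rw [abs_of_nonneg (sub_nonneg.2 (ouVar_antitone ht h)), abs_sub_comm, abs_of_nonneg (sub_nonneg.2 h)]
  have h1 : ouVar r t ^ 2 ≤ ouVar m t ^ 2 :=
    pow_le_pow_left₀ (ouVar_nonneg r ht) (ouVar_antitone ht hr) 2
  nlinarith [ouVar_sub_le_sq h ht]

lemma ouVar_le_inv {r : ℝ} (hr : 0 < r) (t : ℝ) : ouVar r t ≤ 1 / (2 * r) := by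
  rw [ouVar, if_neg hr.ne']
  gcongr
  linarith [Real.exp_pos (-2 * r * t)]

/-- `2 r φ_r(t) = 1 - e^{-2rt}` increases with `r`, so variances at positive rates are comparable
uniformly in time. -/
lemma ouVar_le_mul_ouVar {r r' t : ℝ} (hr : 0 < r) (h : r ≤ r') (ht : 0 ≤ t) :
    ouVar r t ≤ r' / r * ouVar r' t := by
  have hr' := hr.trans_le h
  rw [ouVar, if_neg hr.ne', ouVar, if_neg hr'.ne']
  have h1 : Real.exp (-2 * r' * t) ≤ Real.exp (-2 * r * t) :=
    Real.exp_le_exp.2 (by nlinarith)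
  rw [show r' / r * ((1 - Real.exp (-2 * r' * t)) / (2 * r')) =
    (1 - Real.exp (-2 * r' * t)) / (2 * r) by field_simp]
  gcongr

lemma ouVar_sub_mono {r r' s t : ℝ} (h : r ≤ r') (hs : 0 ≤ s) (hst : s ≤ t) :
    ouVar r s - ouVar r' s ≤ ouVar r t - ouVar r' t := by
  rw [ouVar_sub_ouVar, ouVar_sub_ouVar, ← sub_nonneg,
    intervalIntegral.integral_interval_sub_left (Continuous.intervalIntegrable (by fun_prop) _ _)
      (Continuous.intervalIntegrable (by fun_prop) _ _)]
  refine intervalIntegral.integral_nonneg hst fun x hx => sub_nonneg.2 (Real.exp_le_exp.2 ?_)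
  nlinarith [mul_le_mul_of_nonneg_right h (hs.trans hx.1)]

/-! ### Wiener integrals of continuously differentiable functions -/

open Filter Topology in
/-- Riemann–Stieltjes sums along the uniform partition of `[0, t]`. -/
lemma tendsto_sum_mul_integral {φ ψ : ℝ → ℝ} (hφ : Continuous φ) (hψ : Continuous ψ) {t : ℝ}
    (ht : 0 ≤ t) (τ : ℕ → ℕ → ℝ)
    (hτ : ∀ m i : ℕ, τ m i ∈ Set.Icc (t * i / (m + 1)) (t * (i + 1 : ℕ) / (m + 1))) :
    Tendsto (fun m : ℕ => ∑ i ∈ Finset.range (m + 1),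
      φ (τ m i) * ∫ s in (t * i / (m + 1))..(t * (i + 1 : ℕ) / (m + 1)), ψ s) atTop
      (𝓝 (∫ s in (0 : ℝ)..t, φ s * ψ s)) := by
  obtain ⟨C, hC⟩ := isCompact_Icc.exists_bound_of_continuousOn (s := Set.Icc 0 t) hψ.continuousOn
  have hC0 : 0 ≤ C := (norm_nonneg _).trans (hC 0 ⟨le_rfl, ht⟩)
  have huc := isCompact_Icc.uniformContinuousOn_of_continuous (s := Set.Icc 0 t) hφ.continuousOn
  rw [Metric.uniformContinuousOn_iff_le] at huc
  rw [Metric.tendsto_atTop]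
  intro ε hε
  -- The total error is at most this tolerance times `C * t`; the `+ 1` covers `C * t = 0`.
  obtain ⟨δ, hδ, huc⟩ := huc (ε / (2 * (C * t + 1))) (by positivity)
  obtain ⟨N, hN⟩ := exists_nat_gt (t / δ)
  refine ⟨N, fun m hm => ?_⟩
  have hm0 : (0 : ℝ) < m + 1 := by positivity
  have hmesh : t / (m + 1) ≤ δ := by
    rw [div_le_iff₀ hm0]
    rw [div_lt_iff₀ hδ] at hN
    have : (N : ℝ) ≤ m := by exact_mod_cast hm
    nlinarith
  have hstep : ∀ i : ℕ, t * (i + 1 : ℕ) / (m + 1) = t * i / (m + 1) + t / (m + 1) := by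
    intro i; push_cast; ring
  have hle : ∀ i : ℕ, t * i / (m + 1) ≤ t * (i + 1 : ℕ) / (m + 1) := by
    intro i; rw [hstep]; have : 0 ≤ t / (m + 1) := by positivity
    linarith
  have hsub : ∀ i ∈ Finset.range (m + 1), ∀ s ∈ Set.Icc (t * i / (m + 1)) (t * (i + 1 : ℕ) / (m + 1)),
      s ∈ Set.Icc 0 t := by
    intro i hi s hs
    refine ⟨le_trans (by positivity) hs.1, hs.2.trans ?_⟩
    rw [div_le_iff₀ hm0]
    have : ((i + 1 : ℕ) : ℝ) ≤ m + 1 := by exact_mod_cast Finset.mem_range.1 hi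
    gcongr
  have hfull : ∫ s in (0 : ℝ)..t, φ s * ψ s = ∑ i ∈ Finset.range (m + 1),
      ∫ s in (t * i / (m + 1))..(t * (i + 1 : ℕ) / (m + 1)), φ s * ψ s := by
    rw [intervalIntegral.sum_integral_adjacent_intervals (f := fun s => φ s * ψ s)
      (a := fun i : ℕ => t * i / (m + 1))
      (fun i _ => Continuous.intervalIntegrable (by fun_prop) _ _)]
    congr 1
    · simp
    · push_cast; field_simp
  rw [hfull, dist_eq_norm, ← Finset.sum_sub_distrib]
  have hterm : ∀ i ∈ Finset.range (m + 1),
      ‖φ (τ m i) * (∫ s in (t * i / (m + 1))..(t * (i + 1 : ℕ) / (m + 1)), ψ s) -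
        ∫ s in (t * i / (m + 1))..(t * (i + 1 : ℕ) / (m + 1)), φ s * ψ s‖ ≤
      (ε / (2 * (C * t + 1)) * C) * (t / (m + 1)) := by
    intro i hi
    rw [← intervalIntegral.integral_const_mul, ← intervalIntegral.integral_sub
      (Continuous.intervalIntegrable (by fun_prop) _ _)
      (Continuous.intervalIntegrable (by fun_prop) _ _)]
    refine (intervalIntegral.norm_integral_le_of_norm_le_const
      (C := ε / (2 * (C * t + 1)) * C) fun s hs => ?_).trans_eq ?_
    · rw [Set.uIoc_of_le (hle i)] at hs
      have hs' := Set.Ioc_subset_Icc_self hs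
      rw [← sub_mul, norm_mul]
      refine mul_le_mul ?_ (hC s (hsub i hi s hs')) (norm_nonneg _) (by positivity)
      rw [← dist_eq_norm]
      refine huc _ (hsub i hi _ (hτ m i)) _ (hsub i hi s hs') ?_
      rw [Real.dist_eq, abs_le]
      have h1 := hτ m i
      have h2 := hstep i
      constructor <;> linarith [h1.1, h1.2, hs'.1, hs'.2]
    · rw [hstep, add_sub_cancel_left, abs_of_nonneg (by positivity)]
  calc _ ≤ ∑ i ∈ Finset.range (m + 1), (ε / (2 * (C * t + 1)) * C) * (t / (m + 1)) :=
        (norm_sum_le _ _).trans (Finset.sum_le_sum hterm)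
    _ = ε * (C * t) / (2 * (C * t + 1)) := by
        rw [Finset.sum_const, Finset.card_range]
        simp
        field_simp
    _ < ε := by
        rw [div_lt_iff₀ (by positivity)]
        nlinarith [mul_nonneg hC0 ht]

/-- The points of the uniform partition of `[0, t]` into `m + 1` intervals. -/
noncomputable def gridPt (t : ℝ≥0) (m i : ℕ) : ℝ≥0 := t * i / (m + 1)

/-- The Riemann sums of the Wiener integral `∫ h dw`. -/
noncomputable def wienerSum (h : ℝ → ℝ) (t : ℝ≥0) (m : ℕ) (w : ℝ≥0 → ℝ) : ℝ :=
  ∑ i ∈ Finset.range (m + 1), h (gridPt t m i) * (w (gridPt t m (i + 1)) - w (gridPt t m i))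

/-- The Wiener integral `∫₀ᵗ h dw`, defined by an integration by parts. -/
noncomputable def wienerIntegral (h h' : ℝ → ℝ) (t : ℝ≥0) (w : ℝ≥0 → ℝ) : ℝ :=
  h t * w t - ∫ s in (0 : ℝ)..t, h' s * w s.toNNReal

lemma gridPt_mono (t : ℝ≥0) (m : ℕ) : Monotone (gridPt t m) := by
  intro i j h
  unfold gridPt
  gcongr

lemma coe_gridPt (t : ℝ≥0) (m i : ℕ) : (gridPt t m i : ℝ) = t * i / (m + 1) := by
  simp [gridPt]

lemma gridPt_zero (t : ℝ≥0) (m : ℕ) : gridPt t m 0 = 0 := by simp [gridPt]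

lemma gridPt_last (t : ℝ≥0) (m : ℕ) : gridPt t m (m + 1) = t := by
  simp [gridPt]

open Filter Topology in
-- Summation by parts: `h Δw = Δ(h w) - w Δh` with `w` taken at the right end point and `Δh = ∫ h'`.
-- The first part telescopes, the second is a Riemann–Stieltjes sum.
lemma tendsto_wienerSum {h h' : ℝ → ℝ} (hh : ∀ s, HasDerivAt h (h' s) s) (hh' : Continuous h')
    (t : ℝ≥0) {w : ℝ≥0 → ℝ} (hw : Continuous w) (hw0 : w 0 = 0) :
    Tendsto (fun m => wienerSum h t m w) atTop (𝓝 (wienerIntegral h h' t w)) := by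
  have hφ : Continuous fun s : ℝ => w s.toNNReal := hw.comp continuous_real_toNNReal
  have key := tendsto_sum_mul_integral hφ hh' t.coe_nonneg
    (fun m i => t * (i + 1 : ℕ) / (m + 1)) (fun m i => ⟨by gcongr; simp, le_rfl⟩)
  have hlim : ∫ s in (0 : ℝ)..t, h' s * w s.toNNReal = ∫ s in (0 : ℝ)..t, w s.toNNReal * h' s := by
    simp_rw [mul_comm]
  rw [wienerIntegral, hlim]
  refine (key.const_sub (h t * w t)).congr fun m => ?_
  have hterm : ∀ i : ℕ, w (t * (i + 1 : ℕ) / (m + 1) : ℝ).toNNReal *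
      (∫ s in (t * i / (m + 1) : ℝ)..(t * (i + 1 : ℕ) / (m + 1)), h' s) =
      (h (gridPt t m (i + 1)) * w (gridPt t m (i + 1)) - h (gridPt t m i) * w (gridPt t m i)) -
      h (gridPt t m i) * (w (gridPt t m (i + 1)) - w (gridPt t m i)) := by
    intro i
    rw [← coe_gridPt, ← coe_gridPt, Real.toNNReal_coe,
      intervalIntegral.integral_eq_sub_of_hasDerivAt (fun s _ => hh s) (hh'.intervalIntegrable _ _)]
    ring
  rw [Finset.sum_congr rfl fun i _ => hterm i, Finset.sum_sub_distrib,
    Finset.sum_range_sub (fun i => h (gridPt t m i) * w (gridPt t m i)), gridPt_last, gridPt_zero,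
    hw0, wienerSum]
  ring

lemma measurable_wienerSum (h : ℝ → ℝ) (t : ℝ≥0) (m : ℕ) : Measurable (wienerSum h t m) := by
  unfold wienerSum
  fun_prop

section Brownian

variable {Ω : Type*} [MeasurableSpace Ω] {P : Measure Ω}

lemma aemeasurable_wienerSum {W : ℝ≥0 → Ω → ℝ} (hW : IsPreBrownianReal W P) (h : ℝ → ℝ) (t : ℝ≥0)
    (m : ℕ) : AEMeasurable (fun ω => wienerSum h t m fun s => W s ω) P := by
  unfold wienerSum
  have := hW.aemeasurable
  fun_prop

/-- Grid increments are independent Gaussians of variance `t / (m + 1)`. The frequency `1` suffices,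
since any other can be absorbed in `h`. -/
lemma charFun_map_wienerSum {W : ℝ≥0 → Ω → ℝ} (hW : IsPreBrownianReal W P) (h : ℝ → ℝ) (t : ℝ≥0)
    (m : ℕ) : charFun (P.map fun ω => wienerSum h t m fun s => W s ω) 1 =
      Complex.exp (-((∑ i ∈ Finset.range (m + 1), h (gridPt t m i) ^ 2 * (t / (m + 1)) : ℝ) : ℂ) / 2) := by
  have hind := (hW.hasIndepIncrements.nat (gridPt_mono t m)).comp
    (fun i x => h (gridPt t m i) * x) (fun i => by fun_prop)
  have hae := hW.aemeasurable
  have := (hind.restrict (Finset.range (m + 1))).charFun_map_fun_finsetSum_eq_prod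
    (fun i _ => by simp only [Function.comp_def]; fun_prop)
  simp only [Function.comp_def] at this
  unfold wienerSum
  rw [this, Finset.prod_apply]
  have hlaw : ∀ i, charFun (P.map fun ω => h (gridPt t m i) *
      (W (gridPt t m (i + 1)) ω - W (gridPt t m i) ω)) 1 =
      Complex.exp (-((h (gridPt t m i) ^ 2 * (t / (m + 1)) : ℝ) : ℂ) / 2) := by
    intro i
    have h1 := (hW.hasLaw_sub (gridPt t m (i + 1)) (gridPt t m i))
    have h2 : (nndist ((gridPt t m (i + 1)).1 : ℝ) ((gridPt t m i).1 : ℝ) : ℝ) = t / (m + 1) := by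
      change (nndist ((gridPt t m (i + 1)) : ℝ) ((gridPt t m i) : ℝ) : ℝ) = _
      rw [coe_nndist, Real.dist_eq, coe_gridPt, coe_gridPt,
        show (t : ℝ) * (i + 1 : ℕ) / (m + 1) - t * i / (m + 1) = t / (m + 1) by push_cast; ring,
        abs_of_nonneg (by positivity)]
    have h3 := gaussianReal_const_mul h1 (h (gridPt t m i))
    have h4 := h3.map_eq
    simp only [Pi.sub_apply] at h4
    rw [h4, charFun_gaussianReal]
    congr 1
    simp only [mul_zero, Complex.ofReal_zero, zero_mul, NNReal.coe_mul, NNReal.coe_mk, h2]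
    push_cast
    ring
  rw [Finset.prod_congr rfl fun i _ => hlaw i, ← Complex.exp_sum]
  congr 1
  push_cast
  rw [← Finset.sum_div, Finset.sum_neg_distrib]

open Filter Topology in
/-- The joint characteristic function of Wiener integrals with respect to independent Brownian
motions. -/
theorem integral_cexp_sum_wienerIntegral [IsProbabilityMeasure P] {ι : Type*} [Fintype ι] {W : ι → ℝ≥0 → Ω → ℝ}
    (hW : ∀ i, IsBrownianReal (W i) P) (hind : iIndepFun (fun i ω (t : ℝ≥0) => W i t ω) P)
    {h h' : ι → ℝ → ℝ} (hh : ∀ i s, HasDerivAt (h i) (h' i s) s) (hh' : ∀ i, Continuous (h' i))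
    (t : ℝ≥0) :
    ∫ ω, Complex.exp (((∑ i, wienerIntegral (h i) (h' i) t fun s => W i s ω : ℝ) : ℂ) * Complex.I) ∂P =
      Complex.exp (-((∑ i, ∫ s in (0 : ℝ)..t, h i s ^ 2 : ℝ) : ℂ) / 2) := by
  have hpath : ∀ᵐ ω ∂P, ∀ i, Continuous (fun s => W i s ω) ∧ W i 0 ω = 0 := by
    rw [ae_all_iff]
    intro i
    filter_upwards [(hW i).cont, (hW i).eval_zero_ae_eq_zero] with ω h1 h2
    exact ⟨h1, h2⟩
  have hlim1 : Tendsto (fun m => ∫ ω, Complex.exp (((∑ i, wienerSum (h i) t m fun s => W i s ω : ℝ) : ℂ) *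
      Complex.I) ∂P) atTop (𝓝 (∫ ω, Complex.exp (((∑ i, wienerIntegral (h i) (h' i) t
        fun s => W i s ω : ℝ) : ℂ) * Complex.I) ∂P)) := by
    refine tendsto_integral_of_dominated_convergence (fun _ => 1) (fun m => ?_) (integrable_const _)
      (fun m => ae_of_all _ fun ω => (Complex.norm_exp_ofReal_mul_I _).le) ?_
    · have := fun i => aemeasurable_wienerSum (hW i).toIsPreBrownianReal (h i) t m
      exact (AEMeasurable.cexp (by fun_prop)).aestronglyMeasurable
    · filter_upwards [hpath] with ω hω
      have : Tendsto (fun m => ∑ i, wienerSum (h i) t m fun s => W i s ω) atTop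
          (𝓝 (∑ i, wienerIntegral (h i) (h' i) t fun s => W i s ω)) :=
        tendsto_finsetSum _ fun i _ => tendsto_wienerSum (hh i) (hh' i) t (hω i).1 (hω i).2
      exact ((by fun_prop : Continuous fun x : ℝ => Complex.exp ((x : ℂ) * Complex.I)).tendsto _).comp this
  have hlim2 : Tendsto (fun m : ℕ => Complex.exp (-((∑ i, ∑ j ∈ Finset.range (m + 1),
      h i (gridPt t m j) ^ 2 * (t / (m + 1)) : ℝ) : ℂ) / 2)) atTop
      (𝓝 (Complex.exp (-((∑ i, ∫ s in (0 : ℝ)..t, h i s ^ 2 : ℝ) : ℂ) / 2))) := by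
    have : Tendsto (fun m : ℕ => ∑ i, ∑ j ∈ Finset.range (m + 1),
        h i (gridPt t m j) ^ 2 * ((t : ℝ) / (m + 1))) atTop (𝓝 (∑ i, ∫ s in (0 : ℝ)..t, h i s ^ 2)) := by
      refine tendsto_finsetSum _ fun i _ => ?_
      have hc : Continuous (h i) := continuous_iff_continuousAt.2 fun s => (hh i s).continuousAt
      have key := tendsto_sum_mul_integral (φ := fun s => h i s ^ 2) (ψ := fun _ => 1) (by fun_prop)
        continuous_const t.coe_nonneg (fun m j => t * j / (m + 1)) (fun m j => ⟨le_rfl, by gcongr; simp⟩)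
      simp only [mul_one] at key
      refine key.congr fun m => Finset.sum_congr rfl fun j _ => ?_
      rw [coe_gridPt, intervalIntegral.integral_const, smul_eq_mul, mul_one]
      congr 1
      push_cast
      ring
    exact ((by fun_prop : Continuous fun x : ℝ => Complex.exp (-(x : ℂ) / 2)).tendsto _).comp this
  refine tendsto_nhds_unique hlim1 (hlim2.congr fun m => ?_)
  -- Independence is applied to the sums, which depend measurably on finitely many coordinates of
  -- the path; this is not available for the path integral in the limit.
  have hind' : iIndepFun (fun i ω => wienerSum (h i) t m fun s => W i s ω) P :=
    hind.comp (fun i => wienerSum (h i) t m) fun i => measurable_wienerSum _ _ _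
  have hae := fun i => aemeasurable_wienerSum (hW i).toIsPreBrownianReal (h i) t m
  have hprod := congrFun (hind'.charFun_map_fun_sum_eq_prod hae) 1
  rw [charFun_apply_real, integral_map (by fun_prop) (by fun_prop), Finset.prod_apply,
    Finset.prod_congr rfl fun i _ => charFun_map_wienerSum (hW i).toIsPreBrownianReal (h i) t m,
    ← Complex.exp_sum] at hprod
  simp only [Complex.ofReal_one, one_mul] at hprod
  rw [hprod]
  congr 1
  push_cast
  rw [← Finset.sum_div, Finset.sum_neg_distrib]

end Brownian

/-! ### Linear equations with additive noise -/

/-- The solution at time `t` of `x' = -r x + w'`, `x 0 = 0`. -/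
noncomputable def ouResponse (r : ℝ) (t : ℝ≥0) (w : ℝ≥0 → ℝ) : ℝ :=
  wienerIntegral (fun s => Real.exp (-r * (t - s))) (fun s => r * Real.exp (-r * (t - s))) t w

lemma ouResponse_eq (r : ℝ) (t : ℝ≥0) (w : ℝ≥0 → ℝ) :
    ouResponse r t w = w t - ∫ s in (0 : ℝ)..t, r * Real.exp (-r * (t - s)) * w s.toNNReal := by
  simp [ouResponse, wienerIntegral]

lemma hasDerivAt_exp_neg_mul_sub (r t s : ℝ) :
    HasDerivAt (fun s => Real.exp (-r * (t - s))) (r * Real.exp (-r * (t - s))) s := by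
  have : HasDerivAt (fun s => -r * (t - s)) (-r * -1) s := ((hasDerivAt_id s).const_sub t).const_mul (-r)
  convert this.exp using 1
  ring

/-- The integrating factor is applied to the primitive `G` of `x`: by the equation, `e^{-r(t-u)}
G(u)` has derivative `e^{-r(t-u)} w(u)`. Hence `w` need only be continuous. -/
lemma eq_ouResponse {r : ℝ} {x w : ℝ≥0 → ℝ} (hx : Continuous x) (hw : Continuous w)
    (h : ∀ t : ℝ≥0, x t = -r * (∫ s in (0 : ℝ)..t, x s.toNNReal) + w t) (t : ℝ≥0) :
    x t = ouResponse r t w := by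
  have hx' : Continuous fun s : ℝ => x s.toNNReal := hx.comp continuous_real_toNNReal
  have hw' : Continuous fun s : ℝ => w s.toNNReal := hw.comp continuous_real_toNNReal
  set G : ℝ → ℝ := fun u => ∫ s in (0 : ℝ)..u, x s.toNNReal with hG
  have hGd : ∀ u, HasDerivAt G (x u.toNNReal) u := fun u => hx'.integral_hasStrictDerivAt 0 u |>.hasDerivAt
  have key : ∫ s in (0 : ℝ)..t, r * Real.exp (-r * (t - s)) * w s.toNNReal = r * G t := by
    have hd : ∀ u ∈ Set.uIcc (0 : ℝ) t, HasDerivAt (fun u => r * (Real.exp (-r * (t - u)) * G u))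
        (r * Real.exp (-r * (t - u)) * w u.toNNReal) u := by
      intro u hu
      rw [Set.uIcc_of_le t.coe_nonneg] at hu
      refine (((hasDerivAt_exp_neg_mul_sub r t u).mul (hGd u)).const_mul r).congr_deriv ?_
      have := h u.toNNReal
      rw [Real.coe_toNNReal u hu.1] at this
      rw [this]
      ring
    rw [intervalIntegral.integral_eq_sub_of_hasDerivAt hd
      (Continuous.intervalIntegrable (by fun_prop) _ _)]
    simp [hG]
  rw [ouResponse_eq, key, h t]
  ring

/-- The drift `-A x_i - B ∑ x_j`. -/
def meanFieldDrift (A B : ℝ) (n : ℕ) (x : Fin n → ℝ) (i : Fin n) : ℝ := -A * x i - B * ∑ j, x j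

lemma fullSumDrift_eq (a b : ℝ) (n : ℕ) :
    fullSumDrift a b n = meanFieldDrift a (b / ((n : ℝ) - 1)) n := rfl

lemma otherSumDrift_eq (a b : ℝ) (n : ℕ) :
    otherSumDrift a b n = meanFieldDrift (a + b / ((n : ℝ) - 1)) (-(b / ((n : ℝ) - 1))) n := by
  funext x i
  rw [otherSumDrift, meanFieldDrift, Finset.sum_erase_eq_sub (Finset.mem_univ i)]
  ring

/-- Summing the equations against a vector of zero sum kills the interaction; summing them with
equal weights closes up at the rate `A + n B`. -/
lemma sum_mul_eq_of_meanField {n : ℕ} (hn : n ≠ 0) {A B : ℝ} {w x : Fin n → ℝ≥0 → ℝ}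
    (hx : ∀ i, Continuous (x i)) (hw : ∀ i, Continuous (w i))
    (h : ∀ i (t : ℝ≥0), x i t =
      (∫ s in (0 : ℝ)..t, meanFieldDrift A B n (fun j => x j s.toNNReal) i) + w i t)
    (p : Fin n → ℝ) (t : ℝ≥0) :
    ∑ i, p i * x i t = ouResponse A t (fun s => ∑ i, (p i - (∑ j, p j) / n) * w i s) +
      (∑ j, p j) / n * ouResponse (A + n * B) t (fun s => ∑ i, w i s) := by
  have hn' : (n : ℝ) ≠ 0 := by exact_mod_cast hn
  have hx' : ∀ i, Continuous fun s : ℝ => x i s.toNNReal :=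
    fun i => (hx i).comp continuous_real_toNNReal
  have hint : ∀ i (t : ℝ≥0), x i t = -A * (∫ s in (0 : ℝ)..t, x i s.toNNReal) -
      B * (∑ j, ∫ s in (0 : ℝ)..t, x j s.toNNReal) + w i t := by
    intro i t
    rw [h i t]
    simp only [meanFieldDrift]
    rw [intervalIntegral.integral_sub (Continuous.intervalIntegrable (by fun_prop) _ _)
      (Continuous.intervalIntegrable (by fun_prop) _ _), intervalIntegral.integral_const_mul,
      intervalIntegral.integral_const_mul,
      intervalIntegral.integral_finsetSum fun i _ => (hx' i).intervalIntegrable _ _]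
  have hcomb : ∀ (q : Fin n → ℝ) (t : ℝ≥0), ∑ i, q i * x i t =
      -A * (∫ s in (0 : ℝ)..t, ∑ i, q i * x i s.toNNReal) -
        B * (∑ i, q i) * (∫ s in (0 : ℝ)..t, ∑ j, x j s.toNNReal) + ∑ i, q i * w i t := by
    intro q t
    rw [intervalIntegral.integral_finsetSum fun i _ =>
        Continuous.intervalIntegrable (u := fun s : ℝ => q i * x i s.toNNReal) (by fun_prop) _ _,
      intervalIntegral.integral_finsetSum fun i _ => (hx' i).intervalIntegrable _ _,
      Finset.sum_congr rfl fun i _ => by rw [hint i t]]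
    simp only [intervalIntegral.integral_const_mul, mul_add, mul_sub, Finset.sum_add_distrib,
      Finset.sum_sub_distrib]
    congr 1
    congr 1
    · rw [Finset.mul_sum]
      exact Finset.sum_congr rfl fun i _ => by ring
    · rw [← Finset.sum_mul]
      ring
  have h1 : ∑ i, x i t = ouResponse (A + n * B) t (fun s => ∑ i, w i s) := by
    refine eq_ouResponse (x := fun s => ∑ i, x i s) (by fun_prop) (by fun_prop) (fun t => ?_) t
    have := hcomb (fun _ => 1) t
    simp only [one_mul, Finset.sum_const, Finset.card_univ, Fintype.card_fin, nsmul_eq_mul,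
      mul_one] at this
    rw [this]
    ring
  have h2 : ∑ i, (p i - (∑ j, p j) / n) * x i t =
      ouResponse A t (fun s => ∑ i, (p i - (∑ j, p j) / n) * w i s) := by
    refine eq_ouResponse (x := fun s => ∑ i, (p i - (∑ j, p j) / n) * x i s) (by fun_prop)
      (by fun_prop) (fun t => ?_) t
    have h0 : ∑ i, (p i - (∑ j, p j) / n) = 0 := by
      rw [Finset.sum_sub_distrib, Finset.sum_const, Finset.card_univ, Fintype.card_fin,
        nsmul_eq_mul]
      field_simp
      ring
    have := hcomb (fun i => p i - (∑ j, p j) / n) t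
    rw [h0] at this
    rw [this]
    ring
  rw [← h1, ← h2, Finset.mul_sum, ← Finset.sum_add_distrib]
  exact Finset.sum_congr rfl fun i _ => by ring

/-- Each driving motion enters both responses. Regrouping by motion produces a sum of independent
terms. -/
lemma add_ouResponse_eq_sum_wienerIntegral {ι : Type*} [Fintype ι] {w : ι → ℝ≥0 → ℝ}
    (hw : ∀ i, Continuous (w i)) (r r' : ℝ) (p q : ι → ℝ) (t : ℝ≥0) :
    ouResponse r t (fun s => ∑ i, p i * w i s) + ouResponse r' t (fun s => ∑ i, q i * w i s) =
      ∑ i, wienerIntegral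
        (fun s => p i * Real.exp (-r * (t - s)) + q i * Real.exp (-r' * (t - s)))
        (fun s => p i * (r * Real.exp (-r * (t - s))) + q i * (r' * Real.exp (-r' * (t - s))))
        t (w i) := by
  have hw' : ∀ i, Continuous fun s : ℝ => w i s.toNNReal :=
    fun i => (hw i).comp continuous_real_toNNReal
  have key : ∀ (r : ℝ) (p : ι → ℝ), ouResponse r t (fun s => ∑ i, p i * w i s) =
      ∑ i, p i * ouResponse r t (w i) := by
    intro r p
    simp only [ouResponse_eq, Finset.mul_sum, mul_sub, Finset.sum_sub_distrib]
    rw [intervalIntegral.integral_finsetSum fun i _ => Continuous.intervalIntegrable (by fun_prop) _ _]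
    congr 1
    refine Finset.sum_congr rfl fun i _ => ?_
    rw [← intervalIntegral.integral_const_mul]
    congr 1
    ext s
    ring
  rw [key, key, ← Finset.sum_add_distrib]
  refine Finset.sum_congr rfl fun i _ => ?_
  simp only [ouResponse, wienerIntegral, add_mul, mul_sub]
  rw [intervalIntegral.integral_add (Continuous.intervalIntegrable (by fun_prop) _ _)
    (Continuous.intervalIntegrable (by fun_prop) _ _), ← intervalIntegral.integral_const_mul,
    ← intervalIntegral.integral_const_mul]
  simp only [mul_assoc]
  ring

lemma integral_exp_mul_exp (r t : ℝ) :
    ∫ s in (0 : ℝ)..t, Real.exp (-r * (t - s)) ^ 2 = ouVar r t := by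
  rw [intervalIntegral.integral_comp_sub_left (fun x => Real.exp (-r * x) ^ 2), ouVar_eq_integral]
  simp only [sub_self, sub_zero]
  congr 1
  ext s
  rw [← Real.exp_nat_mul]
  push_cast
  ring_nf

/-- The cross terms carry the factor `∑ p_i = 0`: the two responses are uncorrelated. -/
lemma sum_integral_sq {ι : Type*} [Fintype ι] (r r' t : ℝ) (p : ι → ℝ) (q : ℝ) (hp : ∑ i, p i = 0) :
    ∑ i, ∫ s in (0 : ℝ)..t, (p i * Real.exp (-r * (t - s)) + q * Real.exp (-r' * (t - s))) ^ 2 =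
      ouVar r t * ∑ i, p i ^ 2 + ouVar r' t * (Fintype.card ι * q ^ 2) := by
  have : ∀ i, ∫ s in (0 : ℝ)..t, (p i * Real.exp (-r * (t - s)) + q * Real.exp (-r' * (t - s))) ^ 2 =
      p i ^ 2 * ouVar r t + q ^ 2 * ouVar r' t +
        p i * (2 * q * ∫ s in (0 : ℝ)..t, Real.exp (-r * (t - s)) * Real.exp (-r' * (t - s))) := by
    intro i
    rw [← integral_exp_mul_exp, ← integral_exp_mul_exp, ← mul_assoc,
      ← intervalIntegral.integral_const_mul, ← intervalIntegral.integral_const_mul,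
      ← intervalIntegral.integral_const_mul, ← intervalIntegral.integral_add
      (Continuous.intervalIntegrable (by fun_prop) _ _)
      (Continuous.intervalIntegrable (by fun_prop) _ _), ← intervalIntegral.integral_add
      (Continuous.intervalIntegrable (by fun_prop) _ _)
      (Continuous.intervalIntegrable (by fun_prop) _ _)]
    congr 1
    ext s
    ring
  simp only [this, Finset.sum_add_distrib, ← Finset.sum_mul, hp, Finset.sum_const,
    Finset.card_univ, nsmul_eq_mul]
  ring

/-- The characteristic function of a solution of the linear mean-field system. -/
theorem integral_cexp_meanField {Ω : Type*} [MeasurableSpace Ω] {P : Measure Ω}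
    [IsProbabilityMeasure P] {n : ℕ} (hn : n ≠ 0) {A B : ℝ} {W X : Fin n → ℝ≥0 → Ω → ℝ}
    (h : IsAdditiveNoiseSolution P (meanFieldDrift A B n) W X) (p : Fin n → ℝ) (t : ℝ≥0) :
    ∫ ω, Complex.exp (((∑ i, p i * X i t ω : ℝ) : ℂ) * Complex.I) ∂P =
      Complex.exp (-((ouVar A t * (∑ i, p i ^ 2 - (∑ i, p i) ^ 2 / n) +
        ouVar (A + n * B) t * ((∑ i, p i) ^ 2 / n) : ℝ) : ℂ) / 2) := by
  have hn' : (n : ℝ) ≠ 0 := by exact_mod_cast hn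
  set m : ℝ := (∑ j, p j) / n with hm
  have hsum : ∑ i, p i = n * m := by rw [hm]; field_simp
  have hp0 : ∑ i, (p i - m) = 0 := by
    rw [Finset.sum_sub_distrib, hsum]
    simp
  have hpath : ∀ᵐ ω ∂P, ∑ i, p i * X i t ω = ∑ i, wienerIntegral
        (fun s => (p i - m) * Real.exp (-A * (t - s)) + m * Real.exp (-(A + n * B) * (t - s)))
        (fun s => (p i - m) * (A * Real.exp (-A * (t - s))) +
          m * ((A + n * B) * Real.exp (-(A + n * B) * (t - s))))
        t (fun s => W i s ω) := by
    have hWc : ∀ᵐ ω ∂P, ∀ i, Continuous fun s => W i s ω :=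
      ae_all_iff.2 fun i => (h.brownian i).cont
    filter_upwards [hWc, h.continuous_paths, h.equation] with ω hW hX heq
    rw [← add_ouResponse_eq_sum_wienerIntegral hW A (A + n * B) (fun i => p i - m) (fun _ => m),
      sum_mul_eq_of_meanField (w := fun i s => W i s ω) (x := fun i s => X i s ω) hn hX hW heq p t,
      ← hm]
    congr 1
    -- With zero second coefficients this is linearity of a single response, used to move `m`
    -- inside.
    have := add_ouResponse_eq_sum_wienerIntegral hW (A + n * B) 0 (fun _ => m) (fun _ => 0) t
    have h1 := add_ouResponse_eq_sum_wienerIntegral hW (A + n * B) 0 (fun _ => 1) (fun _ => 0) t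
    simp only [one_mul, zero_mul, Finset.sum_const_zero, add_zero] at this h1
    have h0 : ouResponse 0 t (fun _ => 0) = 0 := by simp [ouResponse_eq]
    rw [h0, add_zero] at this h1
    rw [this, h1, Finset.mul_sum]
    refine Finset.sum_congr rfl fun i _ => ?_
    simp only [wienerIntegral, mul_sub, ← intervalIntegral.integral_const_mul]
    simp only [mul_assoc]
  have hd : ∀ i s, HasDerivAt
      (fun s => (p i - m) * Real.exp (-A * (t - s)) + m * Real.exp (-(A + n * B) * (t - s)))
      ((p i - m) * (A * Real.exp (-A * (t - s))) +
        m * ((A + n * B) * Real.exp (-(A + n * B) * (t - s)))) s :=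
    fun i s => ((hasDerivAt_exp_neg_mul_sub A t s).const_mul (p i - m)).add
      ((hasDerivAt_exp_neg_mul_sub (A + n * B) t s).const_mul m)
  rw [integral_congr_ae (g := fun ω => Complex.exp (((∑ i, wienerIntegral
        (fun s => (p i - m) * Real.exp (-A * (t - s)) + m * Real.exp (-(A + n * B) * (t - s)))
        (fun s => (p i - m) * (A * Real.exp (-A * (t - s))) +
          m * ((A + n * B) * Real.exp (-(A + n * B) * (t - s))))
        t (fun s => W i s ω) : ℝ) : ℂ) * Complex.I)) (hpath.mono fun ω hω => by simp only [hω]),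
    integral_cexp_sum_wienerIntegral h.brownian h.indep hd
      (fun i => by fun_prop) t]
  have := sum_integral_sq A (A + n * B) t (fun i => p i - m) m hp0
  rw [this]
  congr 4
  have h2 : ∑ i, (p i - m) ^ 2 = ∑ i, p i ^ 2 - n * m ^ 2 := by
    simp only [sub_sq, Finset.sum_add_distrib, Finset.sum_sub_distrib, ← Finset.sum_mul,
      ← Finset.mul_sum, hsum]
    simp
    ring
  rw [h2, hsum, Fintype.card_fin]
  field_simp

open Classical in
/-- The characteristic function of the marginals of the linear mean-field system. -/
theorem IsMarginalLaw.charFun_eq {n k : ℕ} (hn : n ≠ 0) {A B : ℝ} {t : ℝ≥0}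
    {μ : Measure (EuclideanSpace ℝ (Fin k))} (h : IsMarginalLaw.{u} (meanFieldDrift A B n) t k μ)
    (θ : EuclideanSpace ℝ (Fin k)) :
    charFun μ θ = Complex.exp (-((ouVar A t * (∑ i, θ i ^ 2 - (∑ i, θ i) ^ 2 / n) +
        ouVar (A + n * B) t * ((∑ i, θ i) ^ 2 / n) : ℝ) : ℂ) / 2) := by
  obtain ⟨Ω, _, P, W, X, e, hP, hsol, rfl⟩ := h
  have hX := hsol.aemeasurable
  have hlp : AEMeasurable (fun ω => WithLp.toLp 2 fun i => X (e i) t ω) P := by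
    have : AEMeasurable (fun ω => fun i => X (e i) t ω) P :=
      aemeasurable_pi_lambda _ fun i => hX (e i) t
    exact (WithLp.measurable_toLp 2 _).comp_aemeasurable this
  -- `θ` extended by zero to the unobserved particles; injectivity of `e` preserves the sum of
  -- squares.
  set p : Fin n → ℝ := fun j => ∑ i, if e i = j then θ i else 0 with hp
  have hsumg : ∀ g : Fin n → ℝ, ∑ j, p j * g j = ∑ i, θ i * g (e i) := by
    intro g
    simp only [hp, Finset.sum_mul]
    rw [Finset.sum_comm]
    refine Finset.sum_congr rfl fun i _ => ?_
    simp [ite_mul]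
  have hpe : ∀ i, p (e i) = θ i := by
    intro i
    simp [hp, e.injective.eq_iff]
  have h1 : ∑ j, p j = ∑ i, θ i := by simpa using hsumg fun _ => 1
  have h2 : ∑ j, p j ^ 2 = ∑ i, θ i ^ 2 := by
    have := hsumg p
    simp only [hpe] at this
    simpa only [sq] using this
  rw [charFun_apply, integral_map hlp (by fun_prop), ← h1, ← h2, ← integral_cexp_meanField hn hsol p t]
  congr 1
  ext ω
  rw [hsumg fun j => X j t ω]
  simp [PiLp.inner_apply]

lemma IsMarginalLaw.isProbabilityMeasure {n k : ℕ} {F : (Fin n → ℝ) → Fin n → ℝ} {t : ℝ≥0}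
    {μ : Measure (EuclideanSpace ℝ (Fin k))} (h : IsMarginalLaw.{u} F t k μ) :
    IsProbabilityMeasure μ := by
  obtain ⟨Ω, _, P, W, X, e, hP, hsol, rfl⟩ := h
  refine Measure.isProbabilityMeasure_map ?_
  have : AEMeasurable (fun ω => fun i => X (e i) t ω) P :=
    aemeasurable_pi_lambda _ fun i => hsol.aemeasurable (e i) t
  exact (WithLp.measurable_toLp 2 _).comp_aemeasurable this

lemma IsMarginalLaw.le {n k : ℕ} {F : (Fin n → ℝ) → Fin n → ℝ} {t : ℝ≥0}
    {μ : Measure (EuclideanSpace ℝ (Fin k))} (h : IsMarginalLaw.{u} F t k μ) : k ≤ n := by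
  obtain ⟨Ω, _, P, W, X, e, hP, hsol, rfl⟩ := h
  simpa using Fintype.card_le_of_embedding e

/-! ### The McKean–Vlasov equation -/

section

variable {Ω : Type*} [MeasurableSpace Ω] {P : Measure Ω} [IsProbabilityMeasure P]

lemma map_ouResponse {W : ℝ≥0 → Ω → ℝ} (hW : IsBrownianReal W P) (r : ℝ) (t : ℝ≥0)
    (hm : AEMeasurable (fun ω => ouResponse r t fun s => W s ω) P) :
    P.map (fun ω => ouResponse r t fun s => W s ω) = gaussianReal 0 (ouVar r t).toNNReal := by
  have := Measure.isProbabilityMeasure_map hm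
  refine Measure.ext_of_charFun ?_
  ext θ
  have key := integral_cexp_sum_wienerIntegral (ι := Unit) (W := fun _ => W) (fun _ => hW)
    iIndepFun.of_subsingleton
    (h := fun _ s => θ * Real.exp (-r * (t - s))) (h' := fun _ s => θ * (r * Real.exp (-r * (t - s))))
    (fun _ s => (hasDerivAt_exp_neg_mul_sub r t s).const_mul θ) (fun _ => by fun_prop) t
  rw [charFun_apply_real, integral_map hm (by fun_prop), charFun_gaussianReal]
  simp only [Finset.univ_unique, Finset.sum_singleton] at key
  have h1 : ∀ w : ℝ≥0 → ℝ, wienerIntegral (fun s => θ * Real.exp (-r * (t - s)))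
      (fun s => θ * (r * Real.exp (-r * (t - s)))) t w = θ * ouResponse r t w := by
    intro w
    simp only [ouResponse, wienerIntegral, mul_sub, ← intervalIntegral.integral_const_mul]
    simp only [mul_assoc]
  have h2 : ∫ s in (0 : ℝ)..t, (θ * Real.exp (-r * (t - s))) ^ 2 = θ ^ 2 * ouVar r t := by
    rw [← integral_exp_mul_exp, ← intervalIntegral.integral_const_mul]
    simp only [mul_pow]
  simp only [h1, h2] at key
  simp only [Complex.ofReal_mul] at key
  rw [key, Real.coe_toNNReal _ (ouVar_nonneg r t.coe_nonneg)]
  congr 1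
  push_cast
  ring

lemma intervalIntegrable_toNNReal {m : ℝ≥0 → ℝ}
    (h : ∀ t : ℝ≥0, IntervalIntegrable (fun s : ℝ => m s.toNNReal) volume 0 t) (a b : ℝ) :
    IntervalIntegrable (fun s : ℝ => m s.toNNReal) volume a b := by
  have h0 : ∀ u : ℝ, IntervalIntegrable (fun s : ℝ => m s.toNNReal) volume 0 u := by
    intro u
    rcases le_total 0 u with hu | hu
    · lift u to ℝ≥0 using hu
      exact h u
    -- At negative times the truncation makes the integrand the constant `m 0`.
    · refine (intervalIntegrable_const (c := m 0)).congr fun s hs => ?_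
      rw [Set.uIoc_of_ge hu] at hs
      simp [Real.toNNReal_of_nonpos hs.2]
  exact (h0 a).symm.trans (h0 b)

/-- The Ornstein–Uhlenbeck equation with zero forcing, so `eq_ouResponse` replaces Gronwall. -/
lemma eq_zero_of_eq_mul_primitive {g : ℝ → ℝ} (hg : Continuous g) {c : ℝ}
    (h : ∀ t : ℝ≥0, g t = c * ∫ s in (0 : ℝ)..t, g s) (t : ℝ≥0) : g t = 0 := by
  have := eq_ouResponse (r := -c) (x := fun s => g s) (w := fun _ => 0) (by fun_prop)
    continuous_const (fun t => ?_) t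
  · simpa [ouResponse_eq] using this
  · rw [h t, neg_neg, add_zero]
    congr 1
    refine intervalIntegral.integral_congr fun s hs => ?_
    rw [Set.uIcc_of_le t.coe_nonneg] at hs
    simp [hs.1]

/-- A function which solves the averaged McKean–Vlasov equation vanishes. -/
lemma eq_zero_of_eq_ouResponse_primitive {m : ℝ≥0 → ℝ} {a q : ℝ}
    (hint : ∀ t : ℝ≥0, IntervalIntegrable (fun s : ℝ => m s.toNNReal) volume 0 t)
    (h : ∀ t : ℝ≥0, m t = ouResponse a t fun s => q * ∫ u in (0 : ℝ)..s, m u.toNNReal) (t : ℝ≥0) :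
    m t = 0 := by
  set g : ℝ → ℝ := fun t => ∫ u in (0 : ℝ)..t, m u.toNNReal with hgdef
  have hg : Continuous g := intervalIntegral.continuous_primitive (intervalIntegrable_toNNReal hint) 0
  -- `D` solves `D' = -a D + q g` with `D 0 = 0`. The hypothesis says `m = D'`, so `g = D` and `m =
  -- (q - a) g`, a homogeneous equation. The argument runs on the primitive `g` because `m` is not
  -- known to be continuous.
  set D : ℝ → ℝ := fun t => Real.exp (-a * t) * ∫ s in (0 : ℝ)..t, Real.exp (a * s) * (q * g s)
    with hD
  have hcont : Continuous fun s => Real.exp (a * s) * (q * g s) := by fun_prop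
  have hDd : ∀ u, HasDerivAt D (-a * D u + q * g u) u := by
    intro u
    have h1 : HasDerivAt (fun t => Real.exp (-a * t)) (Real.exp (-a * u) * (-a)) u := by
      simpa using ((hasDerivAt_id u).const_mul (-a)).exp
    refine (h1.mul (hcont.integral_hasStrictDerivAt 0 u).hasDerivAt).congr_deriv ?_
    have : Real.exp (-a * u) * Real.exp (a * u) = 1 := by rw [← Real.exp_add]; simp
    simp only [hD]
    linear_combination (q * g u) * this
  have hDc : Continuous D := continuous_iff_continuousAt.2 fun u => (hDd u).continuousAt
  have hm : ∀ t : ℝ≥0, m t = -a * D t + q * g t := by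
    intro t
    rw [h t, ouResponse_eq]
    have : ∫ s in (0 : ℝ)..t, a * Real.exp (-a * (t - s)) * (q * ∫ u in (0 : ℝ)..s.toNNReal, m u.toNNReal) =
        a * D t := by
      simp only [hD]
      rw [← mul_assoc, ← intervalIntegral.integral_const_mul]
      refine intervalIntegral.integral_congr fun s hs => ?_
      rw [Set.uIcc_of_le t.coe_nonneg] at hs
      have : Real.exp (-a * (t - s)) = Real.exp (-a * t) * Real.exp (a * s) := by
        rw [← Real.exp_add]; ring_nf
      simp only [hgdef, this, Real.coe_toNNReal s hs.1]
      ring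
    rw [this]
    ring
  have hgD : ∀ t : ℝ≥0, g t = D t := by
    intro t
    have h1 : g t = ∫ u in (0 : ℝ)..t, (-a * D u + q * g u) := by
      refine intervalIntegral.integral_congr fun s hs => ?_
      rw [Set.uIcc_of_le t.coe_nonneg] at hs
      simp only [hm, Real.coe_toNNReal s hs.1]
    rw [h1, intervalIntegral.integral_eq_sub_of_hasDerivAt (fun u _ => hDd u)
      (Continuous.intervalIntegrable (by fun_prop) _ _)]
    simp [hD]
  have hm' : ∀ t : ℝ≥0, m t = (q - a) * g t := by
    intro t
    rw [hm t, ← hgD t]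
    ring
  have hg0 := eq_zero_of_eq_mul_primitive hg (c := q - a) fun t => by
    rw [← intervalIntegral.integral_const_mul]
    refine intervalIntegral.integral_congr fun s hs => ?_
    rw [Set.uIcc_of_le t.coe_nonneg] at hs
    simp only [hm', Real.coe_toNNReal s hs.1]
  rw [hm', hg0, mul_zero]

/-- By linearity `X` is the response to `W` plus the deterministic response to `q ∫ m`. The former
is centered, so `m` equals the latter, which forces `m = 0`. -/
theorem IsMcKeanVlasovSolution.map_eq {a q : ℝ} {W X : ℝ≥0 → Ω → ℝ}
    (h : IsMcKeanVlasovSolution P a q W X) (t : ℝ≥0) : P.map (X t) = limitLaw a t := by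
  set m : ℝ≥0 → ℝ := fun s => ∫ ω, X s ω ∂P with hm
  have hii := intervalIntegrable_toNNReal (m := m) h.intervalIntegrable_mean
  have hg : Continuous fun s : ℝ => ∫ u in (0 : ℝ)..s, m u.toNNReal :=
    intervalIntegral.continuous_primitive hii 0
  have hsol : ∀ᵐ ω ∂P, ∀ t : ℝ≥0, X t ω = ouResponse a t (fun s => W s ω) +
      ouResponse a t fun s => q * ∫ u in (0 : ℝ)..s, m u.toNNReal := by
    filter_upwards [h.brownian.cont, h.continuous_paths, h.equation] with ω hW hX heq t
    have hX' : Continuous fun s : ℝ => X s.toNNReal ω := hX.comp continuous_real_toNNReal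
    have hW' : Continuous fun s : ℝ => W s.toNNReal ω := hW.comp continuous_real_toNNReal
    have hg' : Continuous fun s : ℝ≥0 => ∫ u in (0 : ℝ)..s, m u.toNNReal :=
      hg.comp NNReal.continuous_coe
    have hg'' : Continuous fun s : ℝ => ∫ u in (0 : ℝ)..s.toNNReal, m u.toNNReal :=
      hg'.comp continuous_real_toNNReal
    have := eq_ouResponse (r := a) (x := fun s => X s ω)
      (w := fun s => W s ω + q * ∫ u in (0 : ℝ)..s, m u.toNNReal) hX
      (by fun_prop) (fun t => ?_) t
    · rw [this]
      simp only [ouResponse_eq, mul_add]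
      rw [intervalIntegral.integral_add (Continuous.intervalIntegrable (by fun_prop) _ _)
        (Continuous.intervalIntegrable (by fun_prop) _ _)]
      ring
    · rw [heq t, intervalIntegral.integral_add (Continuous.intervalIntegrable (by fun_prop) _ _)
        ((hii 0 t).const_mul q), intervalIntegral.integral_const_mul,
        intervalIntegral.integral_const_mul]
      ring
  have hae : ∀ t : ℝ≥0, X t =ᵐ[P] fun ω => ouResponse a t (fun s => W s ω) +
      ouResponse a t fun s => q * ∫ u in (0 : ℝ)..s, m u.toNNReal :=
    fun t => hsol.mono fun ω hω => hω t
  -- Measurability is inherited from `X t`, which differs from the response by a constant.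
  have hmeas : ∀ t : ℝ≥0, AEMeasurable (fun ω => ouResponse a t fun s => W s ω) P := by
    intro t
    refine ((h.integrable t).aemeasurable.sub_const
      (ouResponse a t fun s => q * ∫ u in (0 : ℝ)..s, m u.toNNReal)).congr ?_
    filter_upwards [hae t] with ω hω
    rw [hω]
    ring
  have hlaw := fun t => map_ouResponse h.brownian a t (hmeas t)
  have hm0 : ∀ t, m t = 0 := by
    refine eq_zero_of_eq_ouResponse_primitive (a := a) (q := q) h.intervalIntegrable_mean fun t => ?_
    have hL : HasLaw (fun ω => ouResponse a t fun s => W s ω)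
        (gaussianReal 0 (ouVar a t).toNNReal) P := ⟨hmeas t, hlaw t⟩
    have hi : Integrable (fun ω => ouResponse a t fun s => W s ω) P := hL.hasGaussianLaw.integrable
    change ∫ ω, X t ω ∂P = _
    rw [integral_congr_ae (hae t), integral_add hi (integrable_const _), hL.integral_eq]
    simp
  rw [Measure.map_congr (hae t), limitLaw, ← hlaw t]
  simp [hm0, ouResponse_eq]

end

theorem IsMcKeanVlasovLaw.eq_limitLaw {a q : ℝ} {t : ℝ≥0} {μ : Measure ℝ}
    (h : IsMcKeanVlasovLaw.{u} a q t μ) : μ = limitLaw a t := by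
  obtain ⟨Ω, _, P, W, X, hP, hsol, rfl⟩ := h
  exact hsol.map_eq t

/-! ### Relative Fisher information of Gaussian measures -/

/-- The quotient of the densities of `N(0, l)` and `N(0, v)`. -/
noncomputable def gaussianRatio (v l : ℝ) (y : ℝ) : ℝ :=
  √(v / l) * Real.exp (-((1 / l - 1 / v) / 2 * y ^ 2))

lemma gaussianRatio_pos {v l : ℝ} (hv : 0 < v) (hl : 0 < l) (y : ℝ) : 0 < gaussianRatio v l y := by
  unfold gaussianRatio
  positivity

lemma gaussianReal_withDensity_gaussianRatio {v l : ℝ} (hv : 0 < v) (hl : 0 < l) :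
    (gaussianReal 0 v.toNNReal).withDensity (fun y => ENNReal.ofReal (gaussianRatio v l y)) =
      gaussianReal 0 l.toNNReal := by
  have hv' : v.toNNReal ≠ 0 := by simpa using hv
  have hl' : l.toNNReal ≠ 0 := by simpa using hl
  have hmeas : Measurable fun y => ENNReal.ofReal (gaussianRatio v l y) := by
    unfold gaussianRatio
    fun_prop
  rw [gaussianReal_of_var_ne_zero _ hv', gaussianReal_of_var_ne_zero _ hl',
    ← withDensity_mul _ (measurable_gaussianPDF _ _) hmeas]
  congr 1
  ext y
  rw [Pi.mul_apply, gaussianPDF, gaussianPDF, ← ENNReal.ofReal_mul (gaussianPDFReal_nonneg _ _ _)]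
  congr 1
  simp only [gaussianPDFReal, gaussianRatio, Real.coe_toNNReal _ hv.le, Real.coe_toNNReal _ hl.le]
  rw [mul_mul_mul_comm, ← Real.exp_add]
  congr 1
  · have h (x : ℝ) : √(2 * Real.pi * x) = √(2 * Real.pi) * √x := Real.sqrt_mul (by positivity) x
    rw [Real.sqrt_div hv.le, h, h]
    have := (Real.sqrt_pos.2 hv).ne'
    field_simp
  · congr 1
    field_simp
    ring

section

variable {k : ℕ} (b : OrthonormalBasis (Fin k) ℝ (EuclideanSpace ℝ (Fin k)))

/-- The centered Gaussian measure with variances `l i` in the directions `b i`. -/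
noncomputable def diagGaussian (l : Fin k → ℝ) : Measure (EuclideanSpace ℝ (Fin k)) :=
  (Measure.pi fun i => gaussianReal 0 (l i).toNNReal).map fun x => ∑ i, x i • b i

lemma inner_sum_smul (x : Fin k → ℝ) (i : Fin k) : inner ℝ (b i) (∑ j, x j • b j) = x i :=
  b.orthonormal.inner_right_fintype x i

lemma integral_diagGaussian {F : Type*} [NormedAddCommGroup F] [NormedSpace ℝ F] (l : Fin k → ℝ)
    {g : EuclideanSpace ℝ (Fin k) → F} (hg : Continuous g) :
    ∫ x, g x ∂(diagGaussian b l) =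
      ∫ x, g (∑ i, x i • b i) ∂(Measure.pi fun i => gaussianReal 0 (l i).toNNReal) := by
  rw [diagGaussian, integral_map (Continuous.aemeasurable (by fun_prop))]
  exact hg.aestronglyMeasurable

instance isProbabilityMeasure_diagGaussian (l : Fin k → ℝ) :
    IsProbabilityMeasure (diagGaussian b l) :=
  Measure.isProbabilityMeasure_map (Continuous.aemeasurable (by fun_prop))

lemma inner_eq_sum_mul (x : Fin k → ℝ) (θ : EuclideanSpace ℝ (Fin k)) :
    inner ℝ (∑ i, x i • b i) θ = ∑ i, x i * inner ℝ (b i) θ := by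
  rw [sum_inner]
  simp [inner_smul_left]

lemma charFun_diagGaussian {l : Fin k → ℝ} (hl : ∀ i, 0 ≤ l i) (θ : EuclideanSpace ℝ (Fin k)) :
    charFun (diagGaussian b l) θ =
      Complex.exp (-((∑ i, l i * inner ℝ (b i) θ ^ 2 : ℝ) : ℂ) / 2) := by
  rw [charFun_apply, integral_diagGaussian b l (by fun_prop)]
  simp only [inner_eq_sum_mul, Complex.ofReal_sum, Finset.sum_mul, Complex.exp_sum]
  rw [integral_fintype_prod_eq_prod
    (f := fun i x => Complex.exp (((x * inner ℝ (b i) θ : ℝ) : ℂ) * Complex.I))]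
  have : ∀ i, ∫ x, Complex.exp (((x * inner ℝ (b i) θ : ℝ) : ℂ) * Complex.I)
      ∂(gaussianReal 0 (l i).toNNReal) = Complex.exp (-((l i * inner ℝ (b i) θ ^ 2 : ℝ) : ℂ) / 2) := by
    intro i
    have := charFun_gaussianReal (μ := 0) (v := (l i).toNNReal) (inner ℝ (b i) θ)
    rw [charFun_apply_real] at this
    simp only [Complex.ofReal_mul, mul_comm _ ((inner ℝ (b i) θ : ℝ) : ℂ)] at this ⊢
    rw [this, Real.coe_toNNReal _ (hl i)]
    congr 1
    push_cast
    ring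
  rw [Finset.prod_congr rfl fun i _ => this i, ← Complex.exp_sum]
  congr 1
  rw [← Finset.sum_div, Finset.sum_neg_distrib]

lemma charFun_tensorPower {v : ℝ} (hv : 0 ≤ v) (θ : EuclideanSpace ℝ (Fin k)) :
    charFun (tensorPower (gaussianReal 0 v.toNNReal) k) θ =
      Complex.exp (-((v * ∑ i, θ i ^ 2 : ℝ) : ℂ) / 2) := by
  rw [tensorPower, charFun_pi]
  simp only [charFun_gaussianReal]
  rw [← Complex.exp_sum]
  congr 1
  rw [Finset.mul_sum]
  push_cast
  rw [Real.coe_toNNReal _ hv, neg_div, Finset.sum_div, ← Finset.sum_neg_distrib]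
  exact Finset.sum_congr rfl fun i _ => by ring

instance isProbabilityMeasure_tensorPower (μ : Measure ℝ) [IsProbabilityMeasure μ] :
    IsProbabilityMeasure (tensorPower μ k) :=
  Measure.isProbabilityMeasure_map (WithLp.measurable_toLp 2 _).aemeasurable

/-- Parseval: the isotropic Gaussian is a product in every orthonormal basis, so it can be treated
in the eigenbasis of the other measure. -/
lemma diagGaussian_const {v : ℝ} (hv : 0 ≤ v) :
    diagGaussian b (fun _ => v) = tensorPower (gaussianReal 0 v.toNNReal) k := by
  refine Measure.ext_of_charFun ?_
  ext θ
  rw [charFun_diagGaussian b fun _ => hv, charFun_tensorPower hv, ← Finset.mul_sum,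
    b.sum_sq_inner_right, EuclideanSpace.real_norm_sq_eq]

lemma isOpenPosMeasure_gaussianReal {v : ℝ≥0} (hv : v ≠ 0) :
    (gaussianReal 0 v).IsOpenPosMeasure :=
  (gaussianReal_absolutelyContinuous' 0 hv).isOpenPosMeasure

lemma isOpenPosMeasure_tensorPower (μ : Measure ℝ) [SigmaFinite μ] [μ.IsOpenPosMeasure] :
    (tensorPower μ k).IsOpenPosMeasure :=
  (PiLp.continuous_toLp 2 _).isOpenPosMeasure_map (WithLp.toLp_surjective 2)

/-- The density of `diagGaussian b l` with respect to the Gaussian measure of covariance `v I`. -/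
noncomputable def diagDensity (v : ℝ) (l : Fin k → ℝ) (x : EuclideanSpace ℝ (Fin k)) : ℝ :=
  ∏ i, gaussianRatio v (l i) (inner ℝ (b i) x)

lemma diagDensity_eq (v : ℝ) (l : Fin k → ℝ) (x : EuclideanSpace ℝ (Fin k)) :
    diagDensity b v l x = (∏ i, √(v / l i)) *
      Real.exp (∑ i, -((1 / l i - 1 / v) / 2 * inner ℝ (b i) x ^ 2)) := by
  simp only [diagDensity, gaussianRatio, Finset.prod_mul_distrib, Real.exp_sum]

lemma diagDensity_pos {v : ℝ} (hv : 0 < v) {l : Fin k → ℝ} (hl : ∀ i, 0 < l i)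
    (x : EuclideanSpace ℝ (Fin k)) : 0 < diagDensity b v l x :=
  Finset.prod_pos fun i _ => gaussianRatio_pos hv (hl i) _

lemma contDiff_diagDensity (v : ℝ) (l : Fin k → ℝ) : ContDiff ℝ 1 (diagDensity b v l) := by
  rw [show diagDensity b v l = _ from funext (diagDensity_eq b v l)]
  have (i : Fin k) : ContDiff ℝ 1 fun x => inner ℝ (b i) x := contDiff_const.inner ℝ contDiff_id
  fun_prop

lemma integrable_gaussianRatio {v l : ℝ} (hv : 0 < v) (hl : 0 < l) :
    Integrable (gaussianRatio v l) (gaussianReal 0 v.toNNReal) := by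
  have hc : Measurable (gaussianRatio v l) := by unfold gaussianRatio; fun_prop
  refine ⟨hc.aestronglyMeasurable, ?_⟩
  rw [hasFiniteIntegral_iff_ofReal (ae_of_all _ fun y => (gaussianRatio_pos hv hl y).le),
    ← setLIntegral_univ, ← withDensity_apply _ MeasurableSet.univ,
    gaussianReal_withDensity_gaussianRatio hv hl]
  exact measure_lt_top _ _

lemma integrable_diagDensity {v : ℝ} (hv : 0 < v) {l : Fin k → ℝ} (hl : ∀ i, 0 < l i) :
    Integrable (diagDensity b v l) (diagGaussian b fun _ => v) := by
  rw [diagGaussian, integrable_map_measure (contDiff_diagDensity b v l).continuous.aestronglyMeasurable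
    (Continuous.aemeasurable (by fun_prop))]
  have : diagDensity b v l ∘ (fun x : Fin k → ℝ => ∑ i, x i • b i) =
      fun x => ∏ i, gaussianRatio v (l i) (x i) := by
    ext x
    simp only [Function.comp_apply, diagDensity, inner_sum_smul]
  rw [this]
  exact Integrable.fintype_prod fun i => integrable_gaussianRatio hv (hl i)

/-- In the coordinates of `b` the measures and the density are products, so characteristic functions
are compared factor by factor. -/
theorem withDensity_diagDensity {v : ℝ} (hv : 0 < v) {l : Fin k → ℝ} (hl : ∀ i, 0 < l i) :
    (diagGaussian b fun _ => v).withDensity (fun x => ENNReal.ofReal (diagDensity b v l x)) =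
      diagGaussian b l := by
  -- Identification by characteristic functions requires finiteness beforehand.
  have := isFiniteMeasure_withDensity_ofReal (integrable_diagDensity b hv hl).hasFiniteIntegral
  have hc := (contDiff_diagDensity b v l).continuous
  refine Measure.ext_of_charFun ?_
  ext θ
  rw [charFun_apply, charFun_apply, integral_withDensity_eq_integral_toReal_smul (by fun_prop)
    (ae_of_all _ fun _ => ENNReal.ofReal_lt_top)]
  simp only [ENNReal.toReal_ofReal (diagDensity_pos b hv hl _).le]
  rw [integral_diagGaussian b _ (by fun_prop), integral_diagGaussian b _ (by fun_prop)]
  have h1 : ∀ x : Fin k → ℝ, diagDensity b v l (∑ i, x i • b i) •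
      Complex.exp (((inner ℝ (∑ i, x i • b i) θ : ℝ) : ℂ) * Complex.I) =
      ∏ i, (gaussianRatio v (l i) (x i) • Complex.exp (((x i * inner ℝ (b i) θ : ℝ) : ℂ) * Complex.I)) := by
    intro x
    simp only [diagDensity, inner_sum_smul, inner_eq_sum_mul, Complex.ofReal_sum, Finset.sum_mul,
      Complex.exp_sum, Complex.real_smul, Finset.prod_mul_distrib, Complex.ofReal_prod]
  have h2 : ∀ x : Fin k → ℝ,
      Complex.exp (((inner ℝ (∑ i, x i • b i) θ : ℝ) : ℂ) * Complex.I) =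
      ∏ i, Complex.exp (((x i * inner ℝ (b i) θ : ℝ) : ℂ) * Complex.I) := by
    intro x
    simp only [inner_eq_sum_mul, Complex.ofReal_sum, Finset.sum_mul, Complex.exp_sum]
  simp only [h1]
  simp only [h2]
  rw [integral_fintype_prod_eq_prod (f := fun i x => gaussianRatio v (l i) x •
      Complex.exp (((x * inner ℝ (b i) θ : ℝ) : ℂ) * Complex.I)),
    integral_fintype_prod_eq_prod (f := fun i x =>
      Complex.exp (((x * inner ℝ (b i) θ : ℝ) : ℂ) * Complex.I))]
  refine Finset.prod_congr rfl fun i _ => ?_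
  rw [← gaussianReal_withDensity_gaussianRatio hv (hl i),
    integral_withDensity_eq_integral_toReal_smul (by unfold gaussianRatio; fun_prop)
      (ae_of_all _ fun _ => ENNReal.ofReal_lt_top)]
  simp only [ENNReal.toReal_ofReal (gaussianRatio_pos hv (hl i) _).le]

lemma gradient_log_diagDensity {v : ℝ} (hv : 0 < v) {l : Fin k → ℝ} (hl : ∀ i, 0 < l i)
    (x : EuclideanSpace ℝ (Fin k)) :
    gradient (fun y => Real.log (diagDensity b v l y)) x =
      ∑ i, (-((1 / l i - 1 / v) * inner ℝ (b i) x)) • b i := by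
  have hlog : (fun y => Real.log (diagDensity b v l y)) = fun y => Real.log (∏ i, √(v / l i)) +
      ∑ i, -((1 / l i - 1 / v) / 2 * inner ℝ (b i) y ^ 2) := by
    ext y
    have : 0 < ∏ i, √(v / l i) := Finset.prod_pos fun i _ => Real.sqrt_pos.2 (div_pos hv (hl i))
    rw [diagDensity_eq, Real.log_mul this.ne' (Real.exp_pos _).ne', Real.log_exp]
  rw [hlog]
  refine HasGradientAt.gradient ?_
  rw [hasGradientAt_iff_hasFDerivAt]
  have hd : ∀ i, HasFDerivAt (fun y => -((1 / l i - 1 / v) / 2 * inner ℝ (b i) y ^ 2))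
      (-(((1 / l i - 1 / v) / 2) • ((2 * inner ℝ (b i) x) • innerSL ℝ (b i)))) x := by
    intro i
    have h1 : HasFDerivAt (fun y => inner ℝ (b i) y) (innerSL ℝ (b i)) x :=
      (innerSL ℝ (b i)).hasFDerivAt
    refine ((h1.pow 2).const_mul ((1 / l i - 1 / v) / 2)).neg.congr_fderiv ?_
    ext y
    simp
  refine ((HasFDerivAt.fun_sum fun i _ => hd i).const_add _).congr_fderiv ?_
  ext y
  simp only [_root_.sum_apply, _root_.neg_apply,
    _root_.smul_apply, innerSL_apply_apply, smul_eq_mul,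
    InnerProductSpace.toDual_apply_apply, inner_eq_sum_mul]
  exact Finset.sum_congr rfl fun i _ => by ring

lemma norm_sq_sum_smul (c : Fin k → ℝ) : ‖∑ i, c i • b i‖ ^ 2 = ∑ i, c i ^ 2 := by
  rw [← b.sum_sq_inner_right]
  simp only [inner_sum_smul]

lemma integral_sq_gaussianReal (v : ℝ≥0) : ∫ y, y ^ 2 ∂(gaussianReal 0 v) = v := by
  have := variance_id_gaussianReal (μ := 0) (v := v)
  rw [variance_eq_integral (by fun_prop)] at this
  simpa using this

lemma lintegral_sum_sq_diagGaussian {l : Fin k → ℝ} (hl : ∀ i, 0 < l i) (c : Fin k → ℝ) :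
    ∫⁻ x, ENNReal.ofReal (∑ i, (c i * inner ℝ (b i) x) ^ 2) ∂(diagGaussian b l) =
      ENNReal.ofReal (∑ i, c i ^ 2 * l i) := by
  have hi : ∀ i, Integrable (fun x : Fin k → ℝ => (c i * x i) ^ 2)
      (Measure.pi fun i => gaussianReal 0 (l i).toNNReal) := by
    intro i
    have h1 : Integrable (fun y : ℝ => (c i * y) ^ 2) (gaussianReal 0 (l i).toNNReal) :=
      ((memLp_id_gaussianReal' 2 (by simp)).const_mul (c i)).integrable_sq
    exact integrable_comp_eval (μ := fun i => gaussianReal 0 (l i).toNNReal) (i := i)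
      (f := fun y : ℝ => (c i * y) ^ 2) h1
  have hcont : Continuous fun x : EuclideanSpace ℝ (Fin k) => ∑ i, (c i * inner ℝ (b i) x) ^ 2 := by
    fun_prop
  rw [← ofReal_integral_eq_lintegral_ofReal, integral_diagGaussian b l hcont]
  · simp only [inner_sum_smul]
    rw [integral_finsetSum _ fun i _ => hi i]
    congr 1
    refine Finset.sum_congr rfl fun i _ => ?_
    rw [integral_comp_eval (μ := fun i => gaussianReal 0 (l i).toNNReal) (i := i)
      (f := fun y : ℝ => (c i * y) ^ 2)
      (Continuous.aestronglyMeasurable (by fun_prop))]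
    simp only [mul_pow]
    rw [integral_const_mul, integral_sq_gaussianReal, Real.coe_toNNReal _ (hl i).le]
  · rw [diagGaussian, integrable_map_measure hcont.aestronglyMeasurable
      (Continuous.aemeasurable (by fun_prop))]
    simp only [Function.comp_def, inner_sum_smul]
    exact integrable_finsetSum _ fun i _ => hi i
  · exact ae_of_all _ fun x => Finset.sum_nonneg fun i _ => sq_nonneg _

/-- Two continuous densities agree `ν`-almost everywhere, hence everywhere since `ν` charges open
sets: the infimum is over one function. -/
lemma fisherInfo_eq_of_density {μ ν : Measure (EuclideanSpace ℝ (Fin k))} [SigmaFinite ν]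
    [ν.IsOpenPosMeasure] {f : EuclideanSpace ℝ (Fin k) → ℝ} (hf : ContDiff ℝ 1 f)
    (hpos : ∀ x, 0 < f x) (h : μ = ν.withDensity fun x => ENNReal.ofReal (f x)) :
    fisherInfo μ ν =
      ∫⁻ x, ENNReal.ofReal (f x * ‖gradient (fun y => Real.log (f y)) x‖ ^ 2) ∂ν := by
  refine le_antisymm (iInf_le_of_le f (iInf_le_of_le hf (iInf_le_of_le hpos (iInf_le _ h)))) ?_
  refine le_iInf fun g => le_iInf fun hg => le_iInf fun hgpos => le_iInf fun hg' => ?_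
  have hfc := hf.continuous
  have hgc := hg.continuous
  have hae : (fun x => ENNReal.ofReal (f x)) =ᵐ[ν] fun x => ENNReal.ofReal (g x) :=
    (withDensity_eq_iff_of_sigmaFinite (by fun_prop) (by fun_prop)).1 (h.symm.trans hg')
  have heq := (Continuous.ae_eq_iff_eq ν (ENNReal.continuous_ofReal.comp hfc)
    (ENNReal.continuous_ofReal.comp hgc)).1 hae
  have : f = g := by
    ext x
    have := congrFun heq x
    exact (ENNReal.ofReal_eq_ofReal_iff (hpos x).le (hgpos x).le).1 this
  rw [this]

/-- In the direction `b i` the score is linear with slope `1/v - 1/l_i`. Integrated against `f dν =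
dμ`, its square contributes `(1/l_i - 1/v)² l_i`. -/
theorem fisherInfo_diagGaussian {v : ℝ} (hv : 0 < v) {l : Fin k → ℝ} (hl : ∀ i, 0 < l i) :
    fisherInfo (diagGaussian b l) (tensorPower (gaussianReal 0 v.toNNReal) k) =
      ENNReal.ofReal (∑ i, (l i - v) ^ 2 / (v ^ 2 * l i)) := by
  have hv' : v.toNNReal ≠ 0 := by simpa using hv
  have := isOpenPosMeasure_gaussianReal hv'
  have := isOpenPosMeasure_tensorPower (k := k) (gaussianReal 0 v.toNNReal)
  have hc := (contDiff_diagDensity b v l).continuous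
  rw [fisherInfo_eq_of_density (contDiff_diagDensity b v l) (diagDensity_pos b hv hl)
    (by rw [← diagGaussian_const b hv.le, withDensity_diagDensity b hv hl])]
  have h1 : ∀ x, ENNReal.ofReal (diagDensity b v l x *
      ‖gradient (fun y => Real.log (diagDensity b v l y)) x‖ ^ 2) =
      ENNReal.ofReal (diagDensity b v l x) *
        ENNReal.ofReal (∑ i, (-(1 / l i - 1 / v) * inner ℝ (b i) x) ^ 2) := by
    intro x
    rw [gradient_log_diagDensity b hv hl, norm_sq_sum_smul,
      ENNReal.ofReal_mul (diagDensity_pos b hv hl x).le]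
    simp only [neg_mul]
  simp only [h1]
  have h2 := lintegral_withDensity_eq_lintegral_mul (diagGaussian b fun _ => v)
    (f := fun x => ENNReal.ofReal (diagDensity b v l x)) (by fun_prop)
    (g := fun x => ENNReal.ofReal (∑ i, (-(1 / l i - 1 / v) * inner ℝ (b i) x) ^ 2)) (by fun_prop)
  simp only [Pi.mul_apply] at h2
  rw [← diagGaussian_const b hv.le, ← h2, withDensity_diagDensity b hv hl,
    lintegral_sum_sq_diagGaussian b hl]
  congr 1
  refine Finset.sum_congr rfl fun i _ => ?_
  have := (hl i).ne'
  field_simp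
  ring

end

/-! ### Spectrum of `v (I - c J)` and the resulting Fisher information. -/

lemma dotProduct_covMat_mulVec (v c : ℝ) {k : ℕ} (x : Fin k → ℝ) :
    x ⬝ᵥ (covMat v c k).mulVec x = v * (∑ i, x i ^ 2 - c * (∑ i, x i) ^ 2) := by
  have h1 : (Matrix.of fun _ _ : Fin k => (1 : ℝ)).mulVec x = fun _ => ∑ i, x i := by
    ext i
    simp [Matrix.mulVec, dotProduct]
  rw [covMat, Matrix.smul_mulVec, Matrix.sub_mulVec, Matrix.one_mulVec, Matrix.smul_mulVec, h1,
    dotProduct_smul, dotProduct_sub, dotProduct_smul]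
  simp only [dotProduct, smul_eq_mul, ← Finset.sum_mul]
  simp only [sq]

lemma isHermitian_covMat (v c : ℝ) (k : ℕ) : (covMat v c k).IsHermitian := by
  ext i j
  simp [covMat, Matrix.one_apply, eq_comm]

/-- An orthonormal basis containing the normalized vector of ones. -/
lemma exists_orthonormalBasis_ones {k : ℕ} (hk : 1 ≤ k) :
    ∃ (b : OrthonormalBasis (Fin k) ℝ (EuclideanSpace ℝ (Fin k))) (i₀ : Fin k),
      ∀ x : EuclideanSpace ℝ (Fin k), (k : ℝ) * inner ℝ (b i₀) x ^ 2 = (∑ i, x i) ^ 2 := by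
  have hk' : (0 : ℝ) < k := by exact_mod_cast hk
  let i₀ : Fin k := ⟨0, hk⟩
  let u : EuclideanSpace ℝ (Fin k) := WithLp.toLp 2 fun _ => (√k)⁻¹
  have hu : ‖u‖ = 1 := by
    rw [EuclideanSpace.norm_eq]
    simp only [u, Real.norm_eq_abs, sq_abs, Finset.sum_const, Finset.card_univ, Fintype.card_fin,
      nsmul_eq_mul, inv_pow, Real.sq_sqrt hk'.le]
    rw [mul_inv_cancel₀ hk'.ne', Real.sqrt_one]
  have ho : Orthonormal ℝ (({i₀} : Set (Fin k)).domRestrict fun _ => u) := by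
    refine ⟨fun _ => hu, fun i j hij => ?_⟩
    exact absurd (Subsingleton.elim i j) hij
  obtain ⟨b, hb⟩ := ho.exists_orthonormalBasis_extension_of_card_eq (by simp)
  refine ⟨b, i₀, fun x => ?_⟩
  rw [hb i₀ rfl]
  simp only [u, PiLp.inner_apply, RCLike.inner_apply, conj_trivial, ← Finset.sum_mul, mul_pow,
    inv_pow, Real.sq_sqrt hk'.le]
  field_simp

section

variable {k : ℕ} {v c : ℝ}

/-- `J` is `k` times the projection onto the vector of ones, so only the direction `i₀` sees it. -/
lemma sum_diag_eq {b : OrthonormalBasis (Fin k) ℝ (EuclideanSpace ℝ (Fin k))} {i₀ : Fin k}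
    (hb : ∀ x : EuclideanSpace ℝ (Fin k), (k : ℝ) * inner ℝ (b i₀) x ^ 2 = (∑ i, x i) ^ 2)
    (x : EuclideanSpace ℝ (Fin k)) :
    ∑ i, (if i = i₀ then v * (1 - c * k) else v) * inner ℝ (b i) x ^ 2 =
      v * (∑ i, x i ^ 2 - c * (∑ i, x i) ^ 2) := by
  have h1 : ∀ i, (if i = i₀ then v * (1 - c * k) else v) * inner ℝ (b i) x ^ 2 =
      v * inner ℝ (b i) x ^ 2 - if i = i₀ then v * c * (k * inner ℝ (b i) x ^ 2) else 0 := by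
    intro i
    split_ifs <;> ring
  rw [Finset.sum_congr rfl fun i _ => h1 i, Finset.sum_sub_distrib, ← Finset.mul_sum,
    b.sum_sq_inner_right, EuclideanSpace.real_norm_sq_eq, Finset.sum_ite_eq' Finset.univ i₀,
    if_pos (Finset.mem_univ _), hb]
  ring

lemma posDef_covMat (hk : 1 ≤ k) (hv : 0 < v) (hc : 0 < 1 - c * k) : (covMat v c k).PosDef := by
  obtain ⟨b, i₀, hb⟩ := exists_orthonormalBasis_ones hk
  refine Matrix.PosDef.of_dotProduct_mulVec_pos (isHermitian_covMat v c k) fun x hx => ?_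
  rw [star_trivial, dotProduct_covMat_mulVec]
  have key := sum_diag_eq (v := v) (c := c) hb (WithLp.toLp 2 x)
  simp only at key
  rw [← key]
  have hpos : ∀ i, 0 < (if i = i₀ then v * (1 - c * k) else v) := by
    intro i
    split_ifs <;> positivity
  refine Finset.sum_pos' (fun i _ => mul_nonneg (hpos i).le (sq_nonneg _)) ?_
  by_contra! hcon
  have h0 : ∀ i, inner ℝ (b i) (WithLp.toLp 2 x) ^ 2 = 0 := fun i =>
    le_antisymm (by_contra fun h => absurd (hcon i (Finset.mem_univ i))
      (not_le.2 (mul_pos (hpos i) (not_le.1 h)))) (sq_nonneg _)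
  have := b.sum_sq_inner_right (WithLp.toLp 2 x)
  simp only [h0, Finset.sum_const_zero] at this
  have hx0 : WithLp.toLp 2 x = 0 := by
    rw [← norm_eq_zero]
    exact pow_eq_zero_iff (two_ne_zero) |>.1 this.symm
  exact hx ((WithLp.toLp_eq_zero 2).1 hx0)

lemma charFun_covMat (hS : (covMat v c k).PosSemidef) (θ : EuclideanSpace ℝ (Fin k)) :
    charFun (multivariateGaussian 0 (covMat v c k)) θ =
      Complex.exp (-((v * (∑ i, θ i ^ 2 - c * (∑ i, θ i) ^ 2) : ℝ) : ℂ) / 2) := by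
  rw [charFun_multivariateGaussian hS, dotProduct_covMat_mulVec]
  congr 1
  simp
  ring

theorem fisherInfo_covMat {w : ℝ} (hk : 1 ≤ k) (hv : 0 < v) (hw : 0 < w) (hc : 0 < 1 - c * k) :
    fisherInfo (multivariateGaussian 0 (covMat v c k)) (tensorPower (gaussianReal 0 w.toNNReal) k) =
      ENNReal.ofReal (((k : ℝ) - 1) * (v - w) ^ 2 / (w ^ 2 * v) +
        (v * (1 - c * k) - w) ^ 2 / (w ^ 2 * (v * (1 - c * k)))) := by
  obtain ⟨b, i₀, hb⟩ := exists_orthonormalBasis_ones hk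
  have hpos : ∀ i, 0 < (if i = i₀ then v * (1 - c * k) else v) := by
    intro i
    split_ifs <;> positivity
  have heq : multivariateGaussian 0 (covMat v c k) =
      diagGaussian b fun i => if i = i₀ then v * (1 - c * k) else v := by
    refine Measure.ext_of_charFun ?_
    ext θ
    rw [charFun_covMat (posDef_covMat hk hv hc).posSemidef,
      charFun_diagGaussian b fun i => (hpos i).le, sum_diag_eq hb]
  rw [heq, fisherInfo_diagGaussian b hw hpos, ← Finset.add_sum_erase _ _ (Finset.mem_univ i₀)]
  congr 1
  rw [Finset.sum_congr rfl (g := fun _ => (v - w) ^ 2 / (w ^ 2 * v))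
    fun i hi => by rw [if_neg (Finset.ne_of_mem_erase hi)]]
  simp only [if_pos, Finset.sum_const, Finset.card_erase_of_mem (Finset.mem_univ i₀),
    Finset.card_univ, Fintype.card_fin, nsmul_eq_mul, Nat.cast_sub hk, Nat.cast_one]
  ring

end

/-! ### Marginals of the mean-field systems -/

/-- For `k ≤ n` the exceptional eigenvalue lies between `v` and `w`, whence positivity and all
bounds on denominators. -/
lemma mul_one_sub_eq {v w : ℝ} (hv : v ≠ 0) (n k : ℝ) :
    v * (1 - 1 / n * (1 - w / v) * k) = (1 - k / n) * v + k / n * w := by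
  field_simp
  ring

lemma convex_comb_mem {n k : ℕ} (hn : n ≠ 0) (hkn : k ≤ n) {v w m M : ℝ} (hv : v ∈ Set.Icc m M)
    (hw : w ∈ Set.Icc m M) : (1 - (k : ℝ) / n) * v + k / n * w ∈ Set.Icc m M := by
  have h1 : (k : ℝ) / n ≤ 1 := by
    rw [div_le_one (by positivity)]
    exact_mod_cast hkn
  have h0 : 0 ≤ (k : ℝ) / n := by positivity
  have h2 : 0 ≤ 1 - (k : ℝ) / n := sub_nonneg.2 h1
  constructor
  · nlinarith [mul_le_mul_of_nonneg_left hv.1 h2, mul_le_mul_of_nonneg_left hw.1 h0]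
  · nlinarith [mul_le_mul_of_nonneg_left hv.2 h2, mul_le_mul_of_nonneg_left hw.2 h0]

lemma one_sub_corr_mul_pos {n k : ℕ} (hn : n ≠ 0) (hkn : k ≤ n) {v w : ℝ} (hv : 0 < v) (hw : 0 < w) :
    0 < 1 - 1 / n * (1 - w / v) * k := by
  have h := (convex_comb_mem hn hkn (v := v) (w := w) (m := min v w) (M := max v w)
    ⟨min_le_left _ _, le_max_left _ _⟩ ⟨min_le_right _ _, le_max_right _ _⟩).1
  rw [← mul_one_sub_eq hv.ne'] at h
  exact (pos_iff_pos_of_mul_pos (lt_of_lt_of_le (lt_min hv hw) h)).1 hv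

theorem IsMarginalLaw.eq_multivariateGaussian {n k : ℕ} (hn : n ≠ 0) (hk : 1 ≤ k) {A B : ℝ}
    {t : ℝ≥0} (ht : 0 < t) {μ : Measure (EuclideanSpace ℝ (Fin k))}
    (h : IsMarginalLaw.{u} (meanFieldDrift A B n) t k μ) :
    μ = multivariateGaussian 0
      (covMat (ouVar A t) (1 / n * (1 - ouVar (A + n * B) t / ouVar A t)) k) := by
  have := h.isProbabilityMeasure
  have hv : 0 < ouVar A t := ouVar_pos A (by exact_mod_cast ht)
  have hw : 0 < ouVar (A + n * B) t := ouVar_pos _ (by exact_mod_cast ht)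
  refine Measure.ext_of_charFun ?_
  ext θ
  rw [h.charFun_eq hn, charFun_covMat
    (posDef_covMat hk hv (one_sub_corr_mul_pos hn h.le hv hw)).posSemidef]
  congr 4
  field_simp
  ring

/-- The relative Fisher information of `N(0, Σ)` with respect to `N(0, v I)`, where `Σ` has the
eigenvalues `u` (of multiplicity `k - 1`) and `e`. -/
noncomputable def fisherValue (v u e k : ℝ) : ℝ :=
  (k - 1) * (u - v) ^ 2 / (v ^ 2 * u) + (e - v) ^ 2 / (v ^ 2 * e)

open Filter Topology in
-- Lévy continuity: in the characteristic function the terms in `1/n` vanish, and `φ` is continuous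
-- in the rate.
theorem tendsto_integral_of_isMarginalLaw {A B : ℕ → ℝ} {a r : ℝ}
    (hA : Tendsto A atTop (𝓝 a)) (hr : Tendsto (fun n => A n + n * B n) atTop (𝓝 r)) {t : ℝ≥0}
    {k : ℕ} {μ : ℕ → Measure (EuclideanSpace ℝ (Fin k))}
    (h : ∀ᶠ n in atTop, IsMarginalLaw.{u} (meanFieldDrift (A n) (B n) n) t k (μ n))
    (g : EuclideanSpace ℝ (Fin k) →ᵇ ℝ) :
    Tendsto (fun n => ∫ x, g x ∂(μ n)) atTop (𝓝 (∫ x, g x ∂(tensorPower (limitLaw a t) k))) := by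
  classical
  have : IsProbabilityMeasure (limitLaw a t) := by unfold limitLaw; infer_instance
  let μ₀ : ProbabilityMeasure (EuclideanSpace ℝ (Fin k)) := ⟨tensorPower (limitLaw a t) k, inferInstance⟩
  -- Early `μ n` are unconstrained; `μ₀` is a harmless default there.
  let ν : ℕ → ProbabilityMeasure (EuclideanSpace ℝ (Fin k)) := fun n =>
    if hn : IsProbabilityMeasure (μ n) then ⟨μ n, hn⟩ else μ₀
  have hν : ∀ᶠ n in atTop, (ν n : Measure (EuclideanSpace ℝ (Fin k))) = μ n := by
    filter_upwards [h] with n hn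
    have := hn.isProbabilityMeasure
    simp [ν, this]
  have key : Tendsto ν atTop (𝓝 μ₀) := by
    refine ProbabilityMeasure.tendsto_of_tendsto_charFun fun θ => ?_
    have h1 : Tendsto (fun n : ℕ => ouVar (A n) t * (∑ i, θ i ^ 2 - (∑ i, θ i) ^ 2 / (n : ℝ)) +
        ouVar (A n + n * B n) t * ((∑ i, θ i) ^ 2 / (n : ℝ))) atTop
        (𝓝 (ouVar a t * (∑ i, θ i ^ 2 - 0) + ouVar r t * 0)) := by
      have h0 := tendsto_const_div_atTop_nhds_zero_nat ((∑ i, θ i) ^ 2)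
      exact ((((continuous_ouVar t).tendsto a).comp hA).mul (h0.const_sub _)).add
        ((((continuous_ouVar t).tendsto r).comp hr).mul h0)
    have h2 := ((by fun_prop : Continuous fun x : ℝ => Complex.exp (-(x : ℂ) / 2)).tendsto _).comp h1
    have h3 : charFun (μ₀ : Measure (EuclideanSpace ℝ (Fin k))) θ =
        Complex.exp (-((ouVar a t * (∑ i, θ i ^ 2 - 0) + ouVar r t * 0 : ℝ) : ℂ) / 2) := by
      change charFun (tensorPower (limitLaw a t) k) θ = _
      rw [limitLaw, charFun_tensorPower (ouVar_nonneg a t.coe_nonneg), sub_zero, mul_zero, add_zero]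
    rw [h3]
    refine h2.congr' ?_
    filter_upwards [h, hν, eventually_ne_atTop 0] with n hn hνn hn0
    rw [hνn, hn.charFun_eq hn0]
    rfl
  have := ProbabilityMeasure.tendsto_iff_forall_integral_tendsto.1 key g
  refine this.congr' ?_
  filter_upwards [hν] with n hn
  rw [hn]

open Filter Topology in
lemma tendsto_div_sub_one (b : ℝ) : Tendsto (fun n : ℕ => b / ((n : ℝ) - 1)) atTop (𝓝 0) :=
  tendsto_const_nhds.div_atTop
    (tendsto_atTop_add_const_right _ (-1) tendsto_natCast_atTop_atTop)

open Filter Topology in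
lemma tendsto_add_mul_div_sub_one (a b : ℝ) :
    Tendsto (fun n : ℕ => a + n * (b / ((n : ℝ) - 1))) atTop (𝓝 (a + b)) := by
  have h := (tendsto_div_sub_one b).const_add (a + b)
  rw [add_zero] at h
  refine h.congr' ?_
  filter_upwards [eventually_ge_atTop 2] with n hn
  have : (n : ℝ) - 1 ≠ 0 := by
    have : (2 : ℝ) ≤ n := by exact_mod_cast hn
    linarith
  field_simp
  ring

/-! ### First system: bounds at fixed time and uniformly in time. -/

section FullSum

variable {a b : ℝ} {n k : ℕ} {t : ℝ≥0} {μ : Measure (EuclideanSpace ℝ (Fin k))}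

/-- The factor `n/(n-1)` is `2` at `n = 2` and tends to `1`; these extremes are the source of `β`
and `α`. -/
lemma le_div_sub_one (hn : 2 ≤ n) (hb : 0 ≤ b) :
    b ≤ b * n / ((n : ℝ) - 1) ∧ b * n / ((n : ℝ) - 1) ≤ 2 * b := by
  have h2 : (2 : ℝ) ≤ n := by exact_mod_cast hn
  have h1 : (0 : ℝ) < (n : ℝ) - 1 := by linarith
  rw [le_div_iff₀ h1, div_le_iff₀ h1]
  constructor <;> nlinarith

lemma div_sub_one_le (hn : 2 ≤ n) (hb : b ≤ 0) :
    2 * b ≤ b * n / ((n : ℝ) - 1) ∧ b * n / ((n : ℝ) - 1) ≤ b := by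
  have := le_div_sub_one hn (neg_nonneg.2 hb)
  rw [neg_mul, neg_div] at this
  constructor <;> linarith

lemma abs_div_sub_one_le (hn : 2 ≤ n) : |b * n / ((n : ℝ) - 1)| ≤ 2 * |b| := by
  rcases le_total 0 b with hb | hb
  · have := le_div_sub_one hn hb
    rw [abs_of_nonneg hb, abs_of_nonneg (by linarith)]
    exact this.2
  · have := div_sub_one_le hn hb
    rw [abs_of_nonpos hb, abs_of_nonpos (by linarith)]
    linarith

lemma natCast_mul_corrCoef (hn : n ≠ 0) :
    n * corrCoef a b n t = 1 - ouVar (a + b * n / ((n : ℝ) - 1)) t / ouVar a t := by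
  rw [corrCoef]
  field_simp

lemma corrCoef_bounds_of_nonneg (ht : 0 < t) (hn : 2 ≤ n) (hb : 0 ≤ b) :
    alphaCoef a b t / n ≤ corrCoef a b n t ∧ corrCoef a b n t ≤ betaCoef a b t / n := by
  have hn' : (0 : ℝ) < n := by positivity
  have hv : 0 < ouVar a t := ouVar_pos a (by exact_mod_cast ht)
  have hb' := le_div_sub_one hn hb
  rw [div_le_iff₀' hn', le_div_iff₀' hn', natCast_mul_corrCoef (by omega), alphaCoef, betaCoef]
  constructor <;> gcongr
  · exact ouVar_antitone t.coe_nonneg (by linarith)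
  · exact ouVar_antitone t.coe_nonneg (by linarith)

lemma corrCoef_bounds_of_nonpos (ht : 0 < t) (hn : 2 ≤ n) (hb : b ≤ 0) :
    betaCoef a b t / n ≤ corrCoef a b n t ∧ corrCoef a b n t ≤ alphaCoef a b t / n := by
  have hn' : (0 : ℝ) < n := by positivity
  have hv : 0 < ouVar a t := ouVar_pos a (by exact_mod_cast ht)
  have hb' := div_sub_one_le hn hb
  rw [div_le_iff₀' hn', le_div_iff₀' hn', natCast_mul_corrCoef (by omega), alphaCoef, betaCoef]
  constructor <;> gcongr
  · exact ouVar_antitone t.coe_nonneg (by linarith)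
  · exact ouVar_antitone t.coe_nonneg (by linarith)

lemma alphaCoef_nonneg (ht : 0 < t) (hb : 0 ≤ b) : 0 ≤ alphaCoef a b t := by
  have hv : 0 < ouVar a t := ouVar_pos a (by exact_mod_cast ht)
  rw [alphaCoef, sub_nonneg, div_le_one hv]
  exact ouVar_antitone t.coe_nonneg (by linarith)

lemma alphaCoef_nonpos (ht : 0 < t) (hb : b ≤ 0) : alphaCoef a b t ≤ 0 := by
  have hv : 0 < ouVar a t := ouVar_pos a (by exact_mod_cast ht)
  rw [alphaCoef, sub_nonpos, one_le_div hv]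
  exact ouVar_antitone t.coe_nonneg (by linarith)

lemma alphaCoef_ne_zero (ht : 0 < t) (hb : b ≠ 0) : alphaCoef a b t ≠ 0 := by
  have ht' : (0 : ℝ) < t := by exact_mod_cast ht
  have hv : 0 < ouVar a t := ouVar_pos a ht'
  rw [alphaCoef, sub_ne_zero, ne_comm, ne_eq, div_eq_one_iff_eq hv.ne']
  intro h
  have := (ouVar_strictAnti ht').injective h
  exact hb (by linarith)

lemma one_sub_betaCoef_pos (ht : 0 < t) : 0 < 1 - betaCoef a b t := by
  have ht' : (0 : ℝ) < t := by exact_mod_cast ht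
  rw [betaCoef, sub_sub_cancel]
  exact div_pos (ouVar_pos _ ht') (ouVar_pos _ ht')

lemma one_sub_corrCoef_mul_pos (ht : 0 < t) (hn : 2 ≤ n) (hkn : k ≤ n) :
    0 < 1 - corrCoef a b n t * k := by
  have ht' : (0 : ℝ) < t := by exact_mod_cast ht
  exact one_sub_corr_mul_pos (by omega) hkn (ouVar_pos _ ht') (ouVar_pos _ ht')

lemma IsMarginalLaw.eq_of_fullSumDrift (hn : 2 ≤ n) (hk : 1 ≤ k) (ht : 0 < t)
    (h : IsMarginalLaw.{u} (fullSumDrift a b n) t k μ) :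
    μ = multivariateGaussian 0 (covMat (ouVar a t) (corrCoef a b n t) k) := by
  rw [fullSumDrift_eq] at h
  rw [h.eq_multivariateGaussian (by omega) hk ht, corrCoef,
    show a + (n : ℝ) * (b / ((n : ℝ) - 1)) = a + b * n / ((n : ℝ) - 1) by ring]

lemma IsMarginalLaw.fisherInfo_fullSumDrift (hn : 2 ≤ n) (hk : 1 ≤ k) (ht : 0 < t)
    (h : IsMarginalLaw.{u} (fullSumDrift a b n) t k μ) :
    fisherInfo μ (tensorPower (limitLaw a t) k) = ENNReal.ofReal ((corrCoef a b n t) ^ 2 * k ^ 2 /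
      (ouVar a t * (1 - corrCoef a b n t * k))) := by
  have hv : 0 < ouVar a t := ouVar_pos a (by exact_mod_cast ht)
  have hc := one_sub_corrCoef_mul_pos (a := a) (b := b) ht hn h.le
  rw [h.eq_of_fullSumDrift hn hk ht, limitLaw, fisherInfo_covMat hk hv hv hc]
  congr 1
  field_simp
  ring

lemma sq_div_le_of_sq_le {c v d L D : ℝ} {n k : ℕ} (hn : n ≠ 0) (hv : 0 < v) (hd : 0 < d) (hdD : d ≤ D)
    (h : L ^ 2 ≤ (n * c) ^ 2) :
    L ^ 2 / (v * D) * ((k : ℝ) ^ 2 / n ^ 2) ≤ c ^ 2 * k ^ 2 / (v * d) := by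
  have : c ^ 2 * (k : ℝ) ^ 2 / (v * d) = (n * c) ^ 2 / (v * d) * ((k : ℝ) ^ 2 / n ^ 2) := by
    field_simp
  rw [this]
  gcongr

lemma sq_div_le_of_le_sq {c v d U D : ℝ} {n k : ℕ} (hn : n ≠ 0) (hv : 0 < v) (hD : 0 < D) (hdD : D ≤ d)
    (h : (n * c) ^ 2 ≤ U ^ 2) :
    c ^ 2 * k ^ 2 / (v * d) ≤ U ^ 2 / (v * D) * ((k : ℝ) ^ 2 / n ^ 2) := by
  have : c ^ 2 * (k : ℝ) ^ 2 / (v * d) = (n * c) ^ 2 / (v * d) * ((k : ℝ) ^ 2 / n ^ 2) := by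
    field_simp
  rw [this]
  gcongr

/-- Here `0 ≤ α ≤ n c ≤ β`, so `1 - β ≤ 1 - c k ≤ 1`. -/
lemma fullSum_fisher_bounds_of_nonneg (ht : 0 < t) (hn : 2 ≤ n) (hkn : k ≤ n) (hb : 0 ≤ b) :
    (alphaCoef a b t) ^ 2 / ouVar a t * ((k : ℝ) ^ 2 / n ^ 2) ≤
      (corrCoef a b n t) ^ 2 * k ^ 2 / (ouVar a t * (1 - corrCoef a b n t * k)) ∧
    (corrCoef a b n t) ^ 2 * k ^ 2 / (ouVar a t * (1 - corrCoef a b n t * k)) ≤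
      (betaCoef a b t) ^ 2 / (ouVar a t * (1 - betaCoef a b t)) * ((k : ℝ) ^ 2 / n ^ 2) := by
  have hn' : (0 : ℝ) < n := by positivity
  have hk' : (k : ℝ) ≤ n := by exact_mod_cast hkn
  have hv : 0 < ouVar a t := ouVar_pos a (by exact_mod_cast ht)
  have hd := one_sub_corrCoef_mul_pos (a := a) (b := b) ht hn hkn
  obtain ⟨h1, h2⟩ := corrCoef_bounds_of_nonneg (a := a) ht hn hb
  have hα := alphaCoef_nonneg (a := a) ht hb
  have hc : 0 ≤ corrCoef a b n t := (div_nonneg hα hn'.le).trans h1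
  rw [div_le_iff₀' hn'] at h1
  rw [le_div_iff₀' hn'] at h2
  constructor
  · have := sq_div_le_of_sq_le (k := k) (by omega : n ≠ 0) hv hd
      (sub_le_self _ (mul_nonneg hc k.cast_nonneg)) (pow_le_pow_left₀ hα h1 2)
    rwa [mul_one] at this
  · refine sq_div_le_of_le_sq (by omega) hv (one_sub_betaCoef_pos ht) ?_
      (pow_le_pow_left₀ (by positivity) h2 2)
    have := mul_le_mul_of_nonneg_left hk' hc
    linarith

/-- The signs flip: `β ≤ n c ≤ α ≤ 0`, so `1 ≤ 1 - c k ≤ 1 - β`. -/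
lemma fullSum_fisher_bounds_of_nonpos (ht : 0 < t) (hn : 2 ≤ n) (hkn : k ≤ n) (hb : b ≤ 0) :
    (alphaCoef a b t) ^ 2 / (ouVar a t * (1 - betaCoef a b t)) * ((k : ℝ) ^ 2 / n ^ 2) ≤
      (corrCoef a b n t) ^ 2 * k ^ 2 / (ouVar a t * (1 - corrCoef a b n t * k)) ∧
    (corrCoef a b n t) ^ 2 * k ^ 2 / (ouVar a t * (1 - corrCoef a b n t * k)) ≤
      (betaCoef a b t) ^ 2 / ouVar a t * ((k : ℝ) ^ 2 / n ^ 2) := by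
  have hn' : (0 : ℝ) < n := by positivity
  have hk' : (k : ℝ) ≤ n := by exact_mod_cast hkn
  have hv : 0 < ouVar a t := ouVar_pos a (by exact_mod_cast ht)
  have hd := one_sub_corrCoef_mul_pos (a := a) (b := b) ht hn hkn
  obtain ⟨h1, h2⟩ := corrCoef_bounds_of_nonpos (a := a) ht hn hb
  have hα := alphaCoef_nonpos (a := a) ht hb
  have hc : corrCoef a b n t ≤ 0 := h2.trans (div_nonpos_of_nonpos_of_nonneg hα hn'.le)
  rw [div_le_iff₀' hn'] at h1
  rw [le_div_iff₀' hn'] at h2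
  constructor
  · refine sq_div_le_of_sq_le (by omega) hv hd ?_ (by nlinarith)
    have := mul_le_mul_of_nonpos_left hk' hc
    linarith
  · have := sq_div_le_of_le_sq (k := k) (d := 1 - corrCoef a b n t * k) (U := betaCoef a b t)
      (c := corrCoef a b n t) (by omega : n ≠ 0) hv
      one_pos (by linarith [mul_nonpos_of_nonpos_of_nonneg hc (Nat.cast_nonneg (α := ℝ) k)]) (by nlinarith)
    rwa [mul_one] at this

lemma fullSum_fisher_eq (ht : 0 < t) (hn : 2 ≤ n) (w : ℝ)
    (hw : w = ouVar (a + b * n / ((n : ℝ) - 1)) t) :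
    (corrCoef a b n t) ^ 2 * k ^ 2 / (ouVar a t * (1 - corrCoef a b n t * k)) =
      (ouVar a t - w) ^ 2 / (ouVar a t ^ 2 * ((1 - (k : ℝ) / n) * ouVar a t + k / n * w)) *
        ((k : ℝ) ^ 2 / n ^ 2) := by
  have hn' : (n : ℝ) ≠ 0 := by positivity
  have hv : 0 < ouVar a t := ouVar_pos a (by exact_mod_cast ht)
  rw [← mul_one_sub_eq hv.ne', corrCoef, ← hw]
  field_simp

/-- For `b < 0` and small `n` the rate can be negative although `a + b > 0`; this is what `n₀`
excludes. -/
lemma exists_le_add_div_sub_one (hab : 0 < a + b) :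
    ∃ n₀ : ℕ, 2 ≤ n₀ ∧ ∀ n : ℕ, n₀ ≤ n → (a + b) / 2 ≤ a + b * n / ((n : ℝ) - 1) := by
  obtain ⟨N, hN⟩ := exists_nat_gt (2 * |b| / (a + b))
  refine ⟨N + 2, by omega, fun n hn => ?_⟩
  have hn' : (N : ℝ) + 2 ≤ n := by exact_mod_cast hn
  have h1 : (0 : ℝ) < n - 1 := by linarith [N.cast_nonneg (α := ℝ)]
  rw [div_lt_iff₀ hab] at hN
  have h2 : b * n / ((n : ℝ) - 1) = b + b / ((n : ℝ) - 1) := by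
    field_simp
    ring
  have h3 : -((a + b) / 2) ≤ b / ((n : ℝ) - 1) := by
    rw [le_div_iff₀ h1]
    nlinarith [neg_abs_le b]
  rw [h2]
  linarith

/-- All rates lie in `[δ, a + 2|b|]`, so all variances are within a factor `M` of `f = φ_δ(t)`,
whatever `t`. The numerator is `O(f⁴)`, the denominator at least `(f/M)³`, and `f ≤ 1/(2δ)`. -/
lemma fullSum_fisher_le_uniform {δ : ℝ} (hδ : 0 < δ) (hδa : δ ≤ a) (ht : 0 < t) (hn : 2 ≤ n) (hkn : k ≤ n)
    (hr : δ ≤ a + b * n / ((n : ℝ) - 1)) :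
    (corrCoef a b n t) ^ 2 * k ^ 2 / (ouVar a t * (1 - corrCoef a b n t * k)) ≤
      8 * b ^ 2 * ((a + 2 * |b|) / δ) ^ 3 / δ * ((k : ℝ) ^ 2 / n ^ 2) := by
  have ht' : (0 : ℝ) < t := by exact_mod_cast ht
  rw [fullSum_fisher_eq ht hn _ rfl]
  have hr1 := abs_le.1 (abs_div_sub_one_le (b := b) hn)
  set r := a + b * n / ((n : ℝ) - 1) with hrdef
  set M := (a + 2 * |b|) / δ with hM
  have hM0 : 0 < M := div_pos (by linarith [abs_nonneg b]) hδ
  set f := ouVar δ t with hf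
  have hf0 : 0 < f := ouVar_pos δ ht'
  have hcomp : ∀ r', δ ≤ r' → r' ≤ a + 2 * |b| → ouVar r' t ∈ Set.Icc (f / M) f := by
    intro r' h1 h2
    refine ⟨?_, ouVar_antitone ht'.le h1⟩
    rw [div_le_iff₀ hM0]
    refine (ouVar_le_mul_ouVar hδ h1 ht'.le).trans ?_
    rw [mul_comm]
    have h3 := (ouVar_pos r' ht').le
    have h4 : r' / δ ≤ M := by rw [hM]; gcongr
    gcongr
  have hv := hcomp a hδa (by linarith [abs_nonneg b])
  have hw := hcomp r hr (by linarith)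
  have he := (convex_comb_mem (by omega : n ≠ 0) hkn hv hw).1
  set e := (1 - (k : ℝ) / n) * ouVar a t + k / n * ouVar r t
  have hD : (ouVar a t - ouVar r t) ^ 2 ≤ (4 * |b| * f ^ 2) ^ 2 := by
    rw [← sq_abs]
    refine pow_le_pow_left₀ (abs_nonneg _) ?_ 2
    refine (abs_ouVar_sub_le hδa hr ht'.le).trans ?_
    have : |a - r| ≤ 2 * |b| := by
      rw [hrdef, abs_sub_comm, add_sub_cancel_left]
      exact abs_div_sub_one_le hn
    nlinarith [sq_nonneg (ouVar δ t)]
  have hfM : 0 < f / M := by positivity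
  have hden : (f / M) ^ 2 * (f / M) ≤ ouVar a t ^ 2 * e := by
    have := hv.1
    gcongr
  refine mul_le_mul_of_nonneg_right ?_ (by positivity)
  calc (ouVar a t - ouVar r t) ^ 2 / (ouVar a t ^ 2 * e)
      ≤ (4 * |b| * f ^ 2) ^ 2 / ((f / M) ^ 2 * (f / M)) := by gcongr
    _ = 16 * b ^ 2 * M ^ 3 * f := by
        rw [mul_pow, mul_pow, sq_abs]
        field_simp
        ring
    _ ≤ 16 * b ^ 2 * M ^ 3 * (1 / (2 * δ)) := by
        gcongr
        exact ouVar_le_inv hδ t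
    _ = _ := by
        field_simp
        ring

/-- Variances are at most `1/(2δ)`, while the gap between two of them grows with time and with the
distance of the rates. -/
lemma fullSum_fisher_ge_uniform {δ : ℝ} (hδ : 0 < δ) (hδa : δ ≤ a) {t₀ : ℝ≥0} (ht₀ : 0 < t₀)
    (ht : t₀ ≤ t) (hn : 2 ≤ n) (hkn : k ≤ n) (hr : δ ≤ a + b * n / ((n : ℝ) - 1)) :
    8 * δ ^ 3 * (ouVar a t₀ - ouVar (a + b) t₀) ^ 2 * ((k : ℝ) ^ 2 / n ^ 2) ≤
      (corrCoef a b n t) ^ 2 * k ^ 2 / (ouVar a t * (1 - corrCoef a b n t * k)) := by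
  have ht' : (0 : ℝ) < t := by exact_mod_cast ht₀.trans_le ht
  have htt : (t₀ : ℝ) ≤ t := by exact_mod_cast ht
  rw [fullSum_fisher_eq (ht₀.trans_le ht) hn _ rfl]
  set r := a + b * n / ((n : ℝ) - 1) with hrdef
  have hub : ∀ r', δ ≤ r' → ouVar r' t ≤ 1 / (2 * δ) := fun r' h =>
    (ouVar_antitone ht'.le h).trans (ouVar_le_inv hδ t)
  have hv0 := ouVar_pos a ht'
  have hw0 := ouVar_pos r ht'
  have he := convex_comb_mem (by omega : n ≠ 0) hkn (v := ouVar a t) (w := ouVar r t)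
    (m := min (ouVar a t) (ouVar r t)) (M := 1 / (2 * δ)) ⟨min_le_left _ _, hub a hδa⟩
    ⟨min_le_right _ _, hub r hr⟩
  set e := (1 - (k : ℝ) / n) * ouVar a t + k / n * ouVar r t
  have he0 : 0 < e := (lt_min hv0 hw0).trans_le he.1
  have hD : (ouVar a t₀ - ouVar (a + b) t₀) ^ 2 ≤ (ouVar a t - ouVar r t) ^ 2 := by
    rcases le_total 0 b with hb | hb
    · have h1 := le_div_sub_one hn hb
      have h2 := ouVar_sub_mono (show a ≤ a + b by linarith) t₀.coe_nonneg htt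
      have h3 := ouVar_antitone ht'.le (show a + b ≤ r by linarith)
      have h4 := ouVar_antitone t₀.coe_nonneg (show a ≤ a + b by linarith)
      simp only at h3 h4
      exact pow_le_pow_left₀ (by linarith) (by linarith) 2
    · have h1 := div_sub_one_le hn hb
      have h2 := ouVar_sub_mono (show a + b ≤ a by linarith) t₀.coe_nonneg htt
      have h3 := ouVar_antitone ht'.le (show r ≤ a + b by linarith)
      have h4 := ouVar_antitone t₀.coe_nonneg (show a + b ≤ a by linarith)
      simp only at h3 h4
      rw [← neg_sq, ← neg_sq (ouVar a t - ouVar r t)]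
      exact pow_le_pow_left₀ (by linarith) (by linarith) 2
  refine mul_le_mul_of_nonneg_right ?_ (by positivity)
  calc 8 * δ ^ 3 * (ouVar a t₀ - ouVar (a + b) t₀) ^ 2
      = (ouVar a t₀ - ouVar (a + b) t₀) ^ 2 / ((1 / (2 * δ)) ^ 2 * (1 / (2 * δ))) := by
        field_simp
        ring
    _ ≤ (ouVar a t - ouVar r t) ^ 2 / (ouVar a t ^ 2 * e) := by
        have h1 := hub a hδa
        have h2 := he.2
        gcongr

end FullSum

/-! ### Second system: two-sided bounds at fixed time. -/

section OtherSum

variable {a b : ℝ} {n k : ℕ} {t : ℝ≥0} {μ : Measure (EuclideanSpace ℝ (Fin k))}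

lemma otherSum_rate_eq (hn : 2 ≤ n) :
    a + b / ((n : ℝ) - 1) + n * (-(b / ((n : ℝ) - 1))) = a - b := by
  have h2 : (2 : ℝ) ≤ n := by exact_mod_cast hn
  have h1 : (n : ℝ) - 1 ≠ 0 := by linarith
  field_simp
  ring

lemma one_sub_otherCorrCoef_mul_pos (ht : 0 < t) (hn : 2 ≤ n) (hkn : k ≤ n) :
    0 < 1 - otherCorrCoef a b n t * k := by
  have ht' : (0 : ℝ) < t := by exact_mod_cast ht
  exact one_sub_corr_mul_pos (by omega) hkn (ouVar_pos _ ht') (ouVar_pos _ ht')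

lemma IsMarginalLaw.eq_of_otherSumDrift (hn : 2 ≤ n) (hk : 1 ≤ k) (ht : 0 < t)
    (h : IsMarginalLaw.{u} (otherSumDrift a b n) t k μ) :
    μ = multivariateGaussian 0 (covMat (otherVar a b n t) (otherCorrCoef a b n t) k) := by
  rw [otherSumDrift_eq] at h
  rw [h.eq_multivariateGaussian (by omega) hk ht, otherSum_rate_eq hn]
  rfl

lemma IsMarginalLaw.fisherInfo_otherSumDrift (hn : 2 ≤ n) (hk : 1 ≤ k) (ht : 0 < t)
    (h : IsMarginalLaw.{u} (otherSumDrift a b n) t k μ) :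
    fisherInfo μ (tensorPower (limitLaw a t) k) =
      ENNReal.ofReal (fisherValue (ouVar a t) (otherVar a b n t)
        (otherVar a b n t * (1 - otherCorrCoef a b n t * k)) k) := by
  have ht' : (0 : ℝ) < t := by exact_mod_cast ht
  rw [h.eq_of_otherSumDrift hn hk ht, limitLaw, fisherInfo_covMat hk (v := otherVar a b n t)
    (ouVar_pos _ ht') (ouVar_pos a ht') (one_sub_otherCorrCoef_mul_pos ht hn h.le)]
  rfl

lemma otherVar_mul_eq (ht : 0 < t) :
    otherVar a b n t * (1 - otherCorrCoef a b n t * k) =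
      (1 - (k : ℝ) / n) * otherVar a b n t + k / n * ouVar (a - b) t :=
  mul_one_sub_eq (ouVar_pos _ (by exact_mod_cast ht)).ne' _ _

lemma abs_div_sub_one_le_abs (hn : 2 ≤ n) : |b / ((n : ℝ) - 1)| ≤ |b| := by
  have h2 : (2 : ℝ) ≤ n := by exact_mod_cast hn
  rw [abs_div, abs_of_pos (by linarith : (0 : ℝ) < (n : ℝ) - 1)]
  exact div_le_self (abs_nonneg b) (by linarith)

lemma otherSum_variances_mem (hn : 2 ≤ n) :
    ouVar a t ∈ Set.Icc (ouVar (a + |b|) t) (ouVar (a - |b|) t) ∧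
    ouVar (a - b) t ∈ Set.Icc (ouVar (a + |b|) t) (ouVar (a - |b|) t) ∧
    otherVar a b n t ∈ Set.Icc (ouVar (a + |b|) t) (ouVar (a - |b|) t) := by
  have h : ∀ r, a - |b| ≤ r → r ≤ a + |b| →
      ouVar r t ∈ Set.Icc (ouVar (a + |b|) t) (ouVar (a - |b|) t) := fun r h1 h2 =>
    ⟨ouVar_antitone t.coe_nonneg h2, ouVar_antitone t.coe_nonneg h1⟩
  have h1 := abs_le.1 (abs_div_sub_one_le_abs (b := b) hn)
  have h2 := neg_abs_le b
  have h3 := le_abs_self b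
  exact ⟨h _ (by linarith) (by linarith), h _ (by linarith) (by linarith),
    h _ (by linarith) (by linarith)⟩

/-- With `K = 4 φ² |b|`, `φ` at the rate `a - |b|`, the Lipschitz bound gives `|u - v| ≤ K/n` and
`|w - u| ≤ K`, hence `|e - v| ≤ 2Kk/n`. The constant `5` is `1 + 2²`. -/
lemma otherSum_fisherValue_le (ht : 0 < t) (hn : 2 ≤ n) (hk : 1 ≤ k) (hkn : k ≤ n) :
    fisherValue (ouVar a t) (otherVar a b n t) (otherVar a b n t * (1 - otherCorrCoef a b n t * k)) k ≤
      5 * (4 * ouVar (a - |b|) t ^ 2 * |b|) ^ 2 / ouVar (a + |b|) t ^ 3 * ((k : ℝ) ^ 2 / n ^ 2) := by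
  have ht' : (0 : ℝ) < t := by exact_mod_cast ht
  have hn2 : (2 : ℝ) ≤ n := by exact_mod_cast hn
  have hn0 : (0 : ℝ) < n := by linarith
  have hn1 : (0 : ℝ) < (n : ℝ) - 1 := by linarith
  have hk1 : (1 : ℝ) ≤ k := by exact_mod_cast hk
  obtain ⟨hv, hL, hu⟩ := otherSum_variances_mem (a := a) (b := b) (t := t) hn
  have he := convex_comb_mem (by omega : n ≠ 0) hkn hu hL
  rw [otherVar_mul_eq ht]
  have hm0 : 0 < ouVar (a + |b|) t := ouVar_pos _ ht'
  have hudiff : |otherVar a b n t - ouVar a t| ≤ 4 * ouVar (a - |b|) t ^ 2 * |b| / n := by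
    have h1 := abs_le.1 (abs_div_sub_one_le_abs (b := b) hn)
    refine (abs_ouVar_sub_le (m := a - |b|) (by linarith) (by linarith [abs_nonneg b]) ht'.le).trans ?_
    rw [add_sub_cancel_left, abs_div, abs_of_pos hn1]
    have : |b| / ((n : ℝ) - 1) ≤ 2 * |b| / n := by
      rw [div_le_div_iff₀ hn1 hn0]
      nlinarith [abs_nonneg b]
    calc 2 * ouVar (a - |b|) t ^ 2 * (|b| / ((n : ℝ) - 1))
        ≤ 2 * ouVar (a - |b|) t ^ 2 * (2 * |b| / n) := by gcongr
      _ = _ := by ring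
  have hLdiff : |ouVar (a - b) t - otherVar a b n t| ≤ 4 * ouVar (a - |b|) t ^ 2 * |b| := by
    have h1 := abs_le.1 (abs_div_sub_one_le_abs (b := b) hn)
    refine (abs_ouVar_sub_le (m := a - |b|) (by linarith [le_abs_self b]) (by linarith) ht'.le).trans ?_
    have : |a - b - (a + b / ((n : ℝ) - 1))| ≤ 2 * |b| := by
      rw [show a - b - (a + b / ((n : ℝ) - 1)) = -(b + b / ((n : ℝ) - 1)) by ring, abs_neg]
      refine (abs_add_le _ _).trans ?_
      linarith [abs_div_sub_one_le_abs (b := b) hn]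
    nlinarith [sq_nonneg (ouVar (a - |b|) t)]
  set K := 4 * ouVar (a - |b|) t ^ 2 * |b|
  set v := ouVar a t
  set u := otherVar a b n t
  set w := ouVar (a - b) t
  set e := (1 - (k : ℝ) / n) * u + k / n * w with hedef
  set m := ouVar (a + |b|) t
  have hK : 0 ≤ K := (abs_nonneg _).trans hLdiff
  have hediff : |e - v| ≤ 2 * K * k / n := by
    have : e - v = (u - v) + k / n * (w - u) := by rw [hedef]; ring
    rw [this]
    refine (abs_add_le _ _).trans ?_
    rw [abs_mul, abs_of_nonneg (by positivity : (0 : ℝ) ≤ k / n)]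
    have h1 : (k : ℝ) / n * |w - u| ≤ k / n * K := by gcongr
    have h2 : K / n ≤ K * k / n := by
      gcongr
      nlinarith
    calc |u - v| + (k : ℝ) / n * |w - u| ≤ K * k / n + k / n * K := by linarith
      _ = _ := by ring
  have hu2 : (u - v) ^ 2 ≤ (K / n) ^ 2 := by
    rw [← sq_abs]
    exact pow_le_pow_left₀ (abs_nonneg _) hudiff 2
  have he2 : (e - v) ^ 2 ≤ (2 * K * k / n) ^ 2 := by
    rw [← sq_abs]
    exact pow_le_pow_left₀ (abs_nonneg _) hediff 2
  have hv1 := hv.1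
  have hu1 := hu.1
  have he1 := he.1
  have hk2 : (k : ℝ) - 1 ≤ k ^ 2 := by nlinarith
  have hk0 : 0 ≤ (k : ℝ) - 1 := by linarith
  calc fisherValue v u e k ≤ (k : ℝ) ^ 2 * (K / n) ^ 2 / (m ^ 2 * m) + (2 * K * k / n) ^ 2 / (m ^ 2 * m) := by
        unfold fisherValue
        gcongr
    _ = _ := by
        field_simp
        ring

/-- For `k = 1` only `n (e - v) = (w - v) + (n - 1)(u - v)` counts, and its two terms have opposite
signs. The tangent at `a` lies below the graph, so the second is at least `b φ'`, and strictly below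
`w` at `a - b`, so the sum stays above a positive constant. -/
lemma otherSum_fisherValue_ge (hb : b ≠ 0) (ht : 0 < t) (hn : 2 ≤ n) (hk : 1 ≤ k) (hkn : k ≤ n) :
    min ((ouVar (a - b) t - ouVar a t + b * ouVarDeriv a t) ^ 2) ((ouVar a t - ouVar (a - b) t) ^ 2) /
        ouVar (a - |b|) t ^ 3 * ((k : ℝ) ^ 2 / n ^ 2) ≤
      fisherValue (ouVar a t) (otherVar a b n t)
        (otherVar a b n t * (1 - otherCorrCoef a b n t * k)) k := by
  have ht' : (0 : ℝ) < t := by exact_mod_cast ht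
  have hn2 : (2 : ℝ) ≤ n := by exact_mod_cast hn
  have hn0 : (0 : ℝ) < n := by linarith
  have hn1 : (0 : ℝ) < (n : ℝ) - 1 := by linarith
  have hk1 : (1 : ℝ) ≤ k := by exact_mod_cast hk
  obtain ⟨hv, hL, hu⟩ := otherSum_variances_mem (a := a) (b := b) (t := t) hn
  have he := convex_comb_mem (by omega : n ≠ 0) hkn hu hL
  rw [otherVar_mul_eq ht]
  have hm0 : 0 < ouVar (a + |b|) t := ouVar_pos _ ht'
  have hg : 0 < ouVar (a - b) t - ouVar a t + b * ouVarDeriv a t := by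
    have := ouVar_add_mul_deriv_lt a ht' (neg_ne_zero.2 hb)
    rw [← sub_eq_add_neg] at this
    linarith
  have htan : b * ouVarDeriv a t ≤ ((n : ℝ) - 1) * (otherVar a b n t - ouVar a t) := by
    have := ouVar_add_mul_deriv_lt a ht' (div_ne_zero hb hn1.ne')
    have h2 : b / ((n : ℝ) - 1) * ouVarDeriv a t ≤ otherVar a b n t - ouVar a t := by
      rw [otherVar]
      linarith
    calc b * ouVarDeriv a t = ((n : ℝ) - 1) * (b / ((n : ℝ) - 1) * ouVarDeriv a t) := by
          field_simp
      _ ≤ _ := by gcongr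
  have hl : (ouVar a t - ouVar (a - b) t) ^ 2 ≤ (otherVar a b n t - ouVar (a - b) t) ^ 2 := by
    rcases le_total 0 b with hb0 | hb0
    · have h1 := ouVar_antitone ht'.le (show a ≤ a + b / ((n : ℝ) - 1) by
        linarith [div_nonneg hb0 hn1.le])
      have h2 := ouVar_antitone ht'.le (show a - b ≤ a by linarith)
      simp only at h1 h2
      rw [otherVar, ← neg_sq, ← neg_sq (_ - ouVar (a - b) t)]
      exact pow_le_pow_left₀ (by linarith) (by linarith) 2
    · have h1 := ouVar_antitone ht'.le (show a + b / ((n : ℝ) - 1) ≤ a by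
        linarith [div_nonpos_of_nonpos_of_nonneg hb0 hn1.le])
      have h2 := ouVar_antitone ht'.le (show a ≤ a - b by linarith)
      simp only at h1 h2
      rw [otherVar]
      exact pow_le_pow_left₀ (by linarith) (by linarith) 2
  set v := ouVar a t
  set u := otherVar a b n t
  set w := ouVar (a - b) t
  set e := (1 - (k : ℝ) / n) * u + k / n * w with hedef
  set m := ouVar (a + |b|) t
  set M := ouVar (a - |b|) t
  set g := w - v + b * ouVarDeriv a t
  have hG : g ^ 2 ≤ (w - v + ((n : ℝ) - 1) * (u - v)) ^ 2 :=
    pow_le_pow_left₀ hg.le (by linarith) 2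
  -- The squared Frobenius norm of `Σ - v I`, by eigenvalues on the left and by its `k` diagonal and
  -- `k (k - 1)` off-diagonal entries on the right. Entrywise bounds then add up to `k²`.
  have hid : (n : ℝ) ^ 2 * (((k : ℝ) - 1) * (u - v) ^ 2 + (e - v) ^ 2) =
      k * (w - v + ((n : ℝ) - 1) * (u - v)) ^ 2 + k * (k - 1) * (u - w) ^ 2 := by
    rw [hedef]
    field_simp
    ring
  have hmin : min (g ^ 2) ((v - w) ^ 2) * ((k : ℝ) ^ 2 / n ^ 2) ≤
      ((k : ℝ) - 1) * (u - v) ^ 2 + (e - v) ^ 2 := by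
    rw [← mul_div_assoc, div_le_iff₀' (by positivity), hid]
    have h1 : min (g ^ 2) ((v - w) ^ 2) ≤ (w - v + ((n : ℝ) - 1) * (u - v)) ^ 2 :=
      (min_le_left _ _).trans hG
    have h2 : min (g ^ 2) ((v - w) ^ 2) ≤ (u - w) ^ 2 := (min_le_right _ _).trans hl
    have h3 : 0 ≤ (k : ℝ) * (k - 1) := mul_nonneg (by linarith) (by linarith)
    have h4 : (0 : ℝ) ≤ k := by linarith
    nlinarith [mul_le_mul_of_nonneg_left h1 h4, mul_le_mul_of_nonneg_left h2 h3]
  have hv0 : 0 < v := hm0.trans_le hv.1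
  have hu0 : 0 < u := hm0.trans_le hu.1
  have he0 : 0 < e := hm0.trans_le he.1
  have hv2 := hv.2
  have hu2 := hu.2
  have he2 := he.2
  have hM0 : 0 < M := hv0.trans_le hv2
  have hk0 : 0 ≤ (k : ℝ) - 1 := by linarith
  calc min (g ^ 2) ((v - w) ^ 2) / M ^ 3 * ((k : ℝ) ^ 2 / n ^ 2)
      = min (g ^ 2) ((v - w) ^ 2) * ((k : ℝ) ^ 2 / n ^ 2) / M ^ 3 := by ring
    _ ≤ (((k : ℝ) - 1) * (u - v) ^ 2 + (e - v) ^ 2) / M ^ 3 := by gcongr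
    _ = ((k : ℝ) - 1) * (u - v) ^ 2 / (M ^ 2 * M) + (e - v) ^ 2 / (M ^ 2 * M) := by ring
    _ ≤ fisherValue v u e k := by
        unfold fisherValue
        gcongr

end OtherSum

/-! ### The full statement. -/

theorem mainTheorem4 (a b : ℝ) :
    -- The mean-field limit: both McKean–Vlasov equations have the law `N(0, v(t))` at time `t`.
    (∀ (t : ℝ≥0) (μ : Measure ℝ),
      IsMcKeanVlasovLaw.{u} a (-b) t μ ∨ IsMcKeanVlasovLaw.{u} a b t μ → μ = limitLaw a t) ∧
    -- First system: the `k`-marginals, the Fisher information and the two-sided bounds.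
    (∀ (t : ℝ≥0), 0 < t → 0 < ouVar a t ∧ 0 < 1 - betaCoef a b t ∧
      (b ≠ 0 → 0 < (alphaCoef a b t) ^ 2) ∧
      (∀ n : ℕ, 2 ≤ n →
        (0 ≤ b → alphaCoef a b t / n ≤ corrCoef a b n t ∧ corrCoef a b n t ≤ betaCoef a b t / n) ∧
        (b ≤ 0 → betaCoef a b t / n ≤ corrCoef a b n t ∧ corrCoef a b n t ≤ alphaCoef a b t / n)) ∧
      (∀ (n k : ℕ) (μ : Measure (EuclideanSpace ℝ (Fin k))), 2 ≤ n → 1 ≤ k →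
        IsMarginalLaw.{u} (fullSumDrift a b n) t k μ →
        (covMat (ouVar a t) (corrCoef a b n t) k).PosDef ∧
        μ = multivariateGaussian 0 (covMat (ouVar a t) (corrCoef a b n t) k) ∧
        0 < 1 - corrCoef a b n t * k ∧
        fisherInfo μ (tensorPower (limitLaw a t) k) =
          ENNReal.ofReal ((corrCoef a b n t) ^ 2 * k ^ 2 /
            (ouVar a t * (1 - corrCoef a b n t * k))) ∧
        (0 ≤ b →
          ENNReal.ofReal ((alphaCoef a b t) ^ 2 / ouVar a t * (k ^ 2 / n ^ 2)) ≤
            fisherInfo μ (tensorPower (limitLaw a t) k) ∧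
          fisherInfo μ (tensorPower (limitLaw a t) k) ≤
            ENNReal.ofReal ((betaCoef a b t) ^ 2 / (ouVar a t * (1 - betaCoef a b t)) *
              (k ^ 2 / n ^ 2))) ∧
        (b ≤ 0 →
          ENNReal.ofReal ((alphaCoef a b t) ^ 2 / (ouVar a t * (1 - betaCoef a b t)) *
              (k ^ 2 / n ^ 2)) ≤
            fisherInfo μ (tensorPower (limitLaw a t) k) ∧
          fisherInfo μ (tensorPower (limitLaw a t) k) ≤
            ENNReal.ofReal ((betaCoef a b t) ^ 2 / ouVar a t * (k ^ 2 / n ^ 2)))) ∧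
      -- weak convergence of the `k`-marginals
      (∀ (k : ℕ) (μ : ℕ → Measure (EuclideanSpace ℝ (Fin k))),
        (∀ᶠ n in Filter.atTop, IsMarginalLaw.{u} (fullSumDrift a b n) t k (μ n)) →
        ∀ g : EuclideanSpace ℝ (Fin k) →ᵇ ℝ,
          Filter.Tendsto (fun n => ∫ x, g x ∂(μ n)) Filter.atTop
            (nhds (∫ x, g x ∂(tensorPower (limitLaw a t) k))))) ∧
    -- First system: uniformity in time.
    (0 < a → 0 < a + b → ∃ n₀ : ℕ, 2 ≤ n₀ ∧
      (∃ C : ℝ, ∀ (t : ℝ≥0) (n k : ℕ) (μ : Measure (EuclideanSpace ℝ (Fin k))), 0 < t →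
        n₀ ≤ n → 1 ≤ k → IsMarginalLaw.{u} (fullSumDrift a b n) t k μ →
        fisherInfo μ (tensorPower (limitLaw a t) k) ≤ ENNReal.ofReal (C * (k ^ 2 / n ^ 2))) ∧
      (b ≠ 0 → ∀ t₀ : ℝ≥0, 0 < t₀ → ∃ c : ℝ, 0 < c ∧
        ∀ (t : ℝ≥0) (n k : ℕ) (μ : Measure (EuclideanSpace ℝ (Fin k))), t₀ ≤ t →
        n₀ ≤ n → 1 ≤ k → IsMarginalLaw.{u} (fullSumDrift a b n) t k μ →
        ENNReal.ofReal (c * (k ^ 2 / n ^ 2)) ≤ fisherInfo μ (tensorPower (limitLaw a t) k))) ∧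
    -- Second system.
    (∀ (t : ℝ≥0), 0 < t →
      (∀ (n k : ℕ) (μ : Measure (EuclideanSpace ℝ (Fin k))), 2 ≤ n → 1 ≤ k →
        IsMarginalLaw.{u} (otherSumDrift a b n) t k μ →
        0 < otherVar a b n t ∧ 0 < 1 - otherCorrCoef a b n t * k ∧
        (covMat (otherVar a b n t) (otherCorrCoef a b n t) k).PosDef ∧
        μ = multivariateGaussian 0 (covMat (otherVar a b n t) (otherCorrCoef a b n t) k) ∧
        fisherInfo μ (tensorPower (limitLaw a t) k) =
          ENNReal.ofReal
            (((k : ℝ) - 1) * (otherVar a b n t - ouVar a t) ^ 2 /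
                ((ouVar a t) ^ 2 * otherVar a b n t) +
              (otherVar a b n t * (1 - otherCorrCoef a b n t * k) - ouVar a t) ^ 2 /
                ((ouVar a t) ^ 2 * (otherVar a b n t * (1 - otherCorrCoef a b n t * k))))) ∧
      (∃ C : ℝ, ∀ (n k : ℕ) (μ : Measure (EuclideanSpace ℝ (Fin k))), 2 ≤ n → 1 ≤ k →
        IsMarginalLaw.{u} (otherSumDrift a b n) t k μ →
        fisherInfo μ (tensorPower (limitLaw a t) k) ≤ ENNReal.ofReal (C * (k ^ 2 / n ^ 2))) ∧
      (b ≠ 0 → ∃ c : ℝ, 0 < c ∧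
        ∀ (n k : ℕ) (μ : Measure (EuclideanSpace ℝ (Fin k))), 2 ≤ n → 1 ≤ k →
        IsMarginalLaw.{u} (otherSumDrift a b n) t k μ →
        ENNReal.ofReal (c * (k ^ 2 / n ^ 2)) ≤ fisherInfo μ (tensorPower (limitLaw a t) k)) ∧
      (∀ (k : ℕ) (μ : ℕ → Measure (EuclideanSpace ℝ (Fin k))),
        (∀ᶠ n in Filter.atTop, IsMarginalLaw.{u} (otherSumDrift a b n) t k (μ n)) →
        ∀ g : EuclideanSpace ℝ (Fin k) →ᵇ ℝ,
          Filter.Tendsto (fun n => ∫ x, g x ∂(μ n)) Filter.atTop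
            (nhds (∫ x, g x ∂(tensorPower (limitLaw a t) k))))) := by
  refine ⟨fun t μ h => h.elim (·.eq_limitLaw) (·.eq_limitLaw), fun t ht => ?_, fun ha hab => ?_,
    fun t ht => ?_⟩
  · refine ⟨ouVar_pos a (by exact_mod_cast ht), one_sub_betaCoef_pos ht,
      fun hb => sq_pos_of_ne_zero (alphaCoef_ne_zero ht hb), fun n hn =>
        ⟨corrCoef_bounds_of_nonneg ht hn, corrCoef_bounds_of_nonpos ht hn⟩,
      fun n k μ hn hk h => ?_, fun k μ h g => ?_⟩
    · have hc := one_sub_corrCoef_mul_pos (a := a) (b := b) ht hn h.le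
      have hI := h.fisherInfo_fullSumDrift hn hk ht
      refine ⟨posDef_covMat hk (ouVar_pos a (by exact_mod_cast ht)) hc,
        h.eq_of_fullSumDrift hn hk ht, hc, hI, fun hb => ?_, fun hb => ?_⟩
      · obtain ⟨h1, h2⟩ := fullSum_fisher_bounds_of_nonneg (a := a) ht hn h.le hb
        rw [hI]
        exact ⟨ENNReal.ofReal_le_ofReal h1, ENNReal.ofReal_le_ofReal h2⟩
      · obtain ⟨h1, h2⟩ := fullSum_fisher_bounds_of_nonpos (a := a) ht hn h.le hb
        rw [hI]
        exact ⟨ENNReal.ofReal_le_ofReal h1, ENNReal.ofReal_le_ofReal h2⟩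
    · exact tendsto_integral_of_isMarginalLaw (A := fun _ => a) (B := fun n => b / ((n : ℝ) - 1))
        tendsto_const_nhds (tendsto_add_mul_div_sub_one a b) h g
  · obtain ⟨n₀, hn₀, hr⟩ := exists_le_add_div_sub_one hab
    -- A common lower bound for `a` and all the rates with `n ≥ n₀`.
    set δ := min a ((a + b) / 2) with hδ
    have hδ0 : 0 < δ := lt_min ha (by linarith)
    have hr' : ∀ n : ℕ, n₀ ≤ n → δ ≤ a + b * n / ((n : ℝ) - 1) :=
      fun n hn => (min_le_right _ _).trans (hr n hn)
    refine ⟨n₀, hn₀, ⟨8 * b ^ 2 * ((a + 2 * |b|) / δ) ^ 3 / δ, fun t n k μ ht hn hk h => ?_⟩,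
      fun hb t₀ ht₀ => ⟨8 * δ ^ 3 * (ouVar a t₀ - ouVar (a + b) t₀) ^ 2, ?_,
        fun t n k μ ht hn hk h => ?_⟩⟩
    · rw [h.fisherInfo_fullSumDrift (hn₀.trans hn) hk ht]
      exact ENNReal.ofReal_le_ofReal (fullSum_fisher_le_uniform hδ0 (min_le_left _ _) ht
        (hn₀.trans hn) h.le (hr' n hn))
    · have hne : ouVar a t₀ - ouVar (a + b) t₀ ≠ 0 := fun h0 => hb <| by
        have := (ouVar_strictAnti (by exact_mod_cast ht₀ : (0 : ℝ) < t₀)).injective (sub_eq_zero.1 h0)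
        linarith
      have := sq_pos_of_ne_zero hne
      positivity
    · rw [h.fisherInfo_fullSumDrift (hn₀.trans hn) hk (ht₀.trans_le ht)]
      exact ENNReal.ofReal_le_ofReal (fullSum_fisher_ge_uniform hδ0 (min_le_left _ _) ht₀ ht
        (hn₀.trans hn) h.le (hr' n hn))
  · have ht' : (0 : ℝ) < t := by exact_mod_cast ht
    refine ⟨fun n k μ hn hk h => ?_,
      ⟨5 * (4 * ouVar (a - |b|) t ^ 2 * |b|) ^ 2 / ouVar (a + |b|) t ^ 3,
        fun n k μ hn hk h => ?_⟩,
      fun hb => ⟨min ((ouVar (a - b) t - ouVar a t + b * ouVarDeriv a t) ^ 2)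
        ((ouVar a t - ouVar (a - b) t) ^ 2) / ouVar (a - |b|) t ^ 3, ?_,
        fun n k μ hn hk h => ?_⟩, fun k μ h g => ?_⟩
    · have hc := one_sub_otherCorrCoef_mul_pos (a := a) (b := b) ht hn h.le
      exact ⟨ouVar_pos _ ht', hc, posDef_covMat hk (ouVar_pos _ ht') hc,
        h.eq_of_otherSumDrift hn hk ht, h.fisherInfo_otherSumDrift hn hk ht⟩
    · rw [h.fisherInfo_otherSumDrift hn hk ht]
      exact ENNReal.ofReal_le_ofReal (otherSum_fisherValue_le ht hn hk h.le)
    rotate_left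
    · rw [h.fisherInfo_otherSumDrift hn hk ht]
      exact ENNReal.ofReal_le_ofReal (otherSum_fisherValue_ge hb ht hn hk h.le)
    · simp only [otherSumDrift_eq] at h
      refine tendsto_integral_of_isMarginalLaw (A := fun n => a + b / ((n : ℝ) - 1))
        (B := fun n => -(b / ((n : ℝ) - 1))) (r := a - b) ?_ ?_ h g
      · simpa using (tendsto_div_sub_one b).const_add a
      · refine tendsto_const_nhds.congr' ?_
        filter_upwards [Filter.eventually_ge_atTop 2] with n hn
        exact (otherSum_rate_eq hn).symm
    -- The constant is positive by strict convexity at the step `-b` and by injectivity in the rate.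
    · refine div_pos (lt_min (sq_pos_of_pos ?_) (sq_pos_of_ne_zero ?_)) (pow_pos (ouVar_pos _ ht') 3)
      · have := ouVar_add_mul_deriv_lt a ht' (neg_ne_zero.2 hb)
        rw [← sub_eq_add_neg] at this
        linarith
      · intro h0
        have := (ouVar_strictAnti ht').injective (sub_eq_zero.1 h0)
        exact hb (by linarith)
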